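/- All graphs are finite, simple and undirected. The Laplacian spectrum of a graph $G$ is the multiset of eigenvalues of $L(G)=D(G)-A(G)$, where $D(G)$ is the diagonal matrix of vertex degrees and $A(G)$ is the adjacency matrix. Two graphs are $L$-cospectral if they have the same Laplacian spectrum, and $G$ is $L$-DS if every graph $L$-cospectral with $G$ is isomorphic to $G$. Write $G+H$ for the disjoint union of $G$ and $H$, $kG$ for the disjoint union of $k$ copies of $G$, and $G\times H$ for the graph obtained from $G+H$ by adding all edges joining a vertex of $G$ to a vertex of $H$. Let $K_m$, $P_m$, $C_m$ be the complete graph, path and cycle on $m$ vertices ($m\ge 3$ for $C_m$); $K_0$ is the graph without vertices. 1. For all integers $n\ge 3$ with $n\ne 6$ and all $m\ge 1$, the graph $C_n\times K_m$ is $L$-DS. 2. Let $H_1=2K_1\times(2P_2+K_1)$. For every $m\ge 1$, the graph $H_1\times K_{m-1}$ is $L$-cospectral with $C_6\times K_m$ and not isomorphic to it, and every graph $L$-cospectral with $C_6\times K_m$ is isomorphic to $C_6\times K_m$ or to $H_1\times K_{m-1}$. -/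

import Mathlib

open SimpleGraph

universe u v

open Classical in
/-- The Laplacian spectrum of a finite simple graph: the multiset of the eigenvalues, with
multiplicity, of the real symmetric matrix `L(G) = D(G) - A(G)`. -/
noncomputable def lapSpec {V : Type u} [Fintype V] (G : SimpleGraph V) : Multiset ℝ :=
  (Finset.univ : Finset V).val.map (G.isHermitian_lapMatrix ℝ).eigenvalues

/-- Two finite graphs are `L`-cospectral if they share the same Laplacian spectrum. -/
def LCospectral {V : Type u} {W : Type v} [Fintype V] [Fintype W]
    (G : SimpleGraph V) (H : SimpleGraph W) : Prop :=
  lapSpec G = lapSpec H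

/-- A finite graph is `L`-DS (determined by its Laplacian spectrum) if every graph
`L`-cospectral with it is isomorphic to it. -/
def IsLDS {V : Type u} [Fintype V] (G : SimpleGraph V) : Prop :=
  ∀ (W : Type u) [Fintype W] (H : SimpleGraph W), LCospectral H G → Nonempty (H ≃g G)

/-- The product (join) of two graphs: their disjoint union together with all the edges joining
a vertex of the first to a vertex of the second. -/
def graphProduct {V : Type u} {W : Type v} (G : SimpleGraph V) (H : SimpleGraph W) :
    SimpleGraph (V ⊕ W) :=
  (G ⊕g H) ⊔ completeBipartiteGraph V W

/-- The graph `H₁ = 2K₁ × (2P₂ + K₁)`, on seven vertices. -/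
def graphH1 :
    SimpleGraph ((Fin 1 ⊕ Fin 1) ⊕ ((Fin 2 ⊕ Fin 2) ⊕ Fin 1)) :=
  graphProduct (completeGraph (Fin 1) ⊕g completeGraph (Fin 1))
    ((pathGraph 2 ⊕g pathGraph 2) ⊕g completeGraph (Fin 1))

/-! Write `L` for the Laplacian of the complement of a graph `G` cospectral with `C_n × K_m`. Equal
spectra give a linear isometry intertwining the two Laplacians (`LCospectral.exists_isLapIsometry`).
Since `C_n × K_m` is connected, the isometry sends constants to constants, so it also intertwines
the Laplacians of the complements (`IsLapIsometry.compl`) and the orthogonal projections `P` onto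
their kernels (`IsLapIsometry.map_avgMatrix`). The complement of `C_n × K_m` is the complement of
`C_n` plus `m` isolated vertices.

At a vertex of degree `d` in a component of size `s`, the diagonal entries of `L`, `L²` and `P` are
`d`, `d² + d` and `1/s`. Traces therefore fix `∑ d = n(n-3)`, `∑ d² = n(n-3)²` and, for `n ≥ 5`, `∑
(1 - 1/s) = n - 1`, which is the sum of `s - 1` over components. Relations between `L` and `P` valid
for the model also hold on the diagonal, vertex by vertex.

For `n ≤ 4` the sums force maximum degree one, and a matching is determined by its size. For `n =
5`, `L² - 5L + 5(1 - P) = 0` gives `s((d-2)² + 1) = 5`, so components have size 1 or 5. For `n ≥ 6`,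
the spectral gap gives `(n-4)(1 - 1/s) ≤ d`; with the sums this leaves a single nontrivial component
of size `n`, or else `n = 6` with components of sizes 5 and 2 (`exists_compSize_eq_or_of_six_le`).
In the first case `G = X × K_m`, where `X` is shown to be 2-regular and connected, hence a cycle; in
the second the degree sums identify `H₁ × K_{m-1}`. That this exception is cospectral is witnessed
by an explicit integer matrix intertwining the seven-vertex graphs `H₁` and `C_6 × K_1`, with
constant row and column sums so that it extends to joins. -/

section Laplacian

/-! ### Laplacian quadratic form, complements and traces -/

open scoped Classical
open Matrix

variable {V : Type*} {W : Type*} [Fintype V] [Fintype W]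

/-- The real Laplacian matrix, with classical decidability instances. -/
noncomputable def lap (G : SimpleGraph V) : Matrix V V ℝ := G.lapMatrix ℝ

/-- The degree of a vertex, with classical decidability instances. -/
noncomputable def deg (G : SimpleGraph V) (v : V) : ℕ := G.degree v

theorem deg_eq_degree (G : SimpleGraph V) (v : V) [Fintype (G.neighborSet v)] :
    deg G v = G.degree v := by
  unfold deg
  convert rfl

theorem deg_eq_card_filter (G : SimpleGraph V) (v : V) :
    deg G v = (Finset.univ.filter (G.Adj v)).card := by
  rw [deg, ← card_neighborFinset_eq_degree, neighborFinset_eq_filter]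

theorem deg_iso {G : SimpleGraph V} {H : SimpleGraph W} (f : G ≃g H) (v : V) :
    deg H (f v) = deg G v :=
  f.degree_eq v

theorem deg_compl (G : SimpleGraph V) (v : V) :
    deg Gᶜ v + deg G v + 1 = Fintype.card V := by
  have h := G.degree_compl v
  have h2 := G.degree_lt_card_verts v
  rw [deg_eq_degree, deg_eq_degree, h]
  omega

theorem lap_mulVec_apply (G : SimpleGraph V) (x : V → ℝ) (v : V) :
    (lap G *ᵥ x) v = ∑ w, if G.Adj v w then x v - x w else 0 := by
  rw [lap, lapMatrix_mulVec_apply, degree_eq_sum_if_adj, Finset.sum_mul, neighborFinset_eq_filter,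
    Finset.sum_filter, ← Finset.sum_sub_distrib]
  refine Finset.sum_congr rfl fun w _ => ?_
  split_ifs <;> simp

theorem lap_isSymm (G : SimpleGraph V) : (lap G).IsSymm := G.isSymm_lapMatrix ℝ

theorem lap_dotProduct_comm (G : SimpleGraph V) (x y : V → ℝ) :
    x ⬝ᵥ (lap G *ᵥ y) = (lap G *ᵥ x) ⬝ᵥ y := by
  rw [dotProduct_mulVec, ← mulVec_transpose, lap_isSymm]

theorem lap_dotProduct_self (G : SimpleGraph V) (x : V → ℝ) :
    x ⬝ᵥ (lap G *ᵥ x) = (∑ i, ∑ j, if G.Adj i j then (x i - x j) ^ 2 else 0) / 2 := by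
  rw [lap, ← lapMatrix_toLinearMap₂', toLinearMap₂'_apply']

theorem lap_mulVec_eq_zero_iff (G : SimpleGraph V) (x : V → ℝ) :
    lap G *ᵥ x = 0 ↔ ∀ i j, G.Reachable i j → x i = x j :=
  G.lapMatrix_mulVec_eq_zero_iff_forall_reachable

theorem lap_mulVec_const (G : SimpleGraph V) (c : ℝ) : lap G *ᵥ (fun _ => c) = 0 :=
  (lap_mulVec_eq_zero_iff G _).2 fun _ _ _ => rfl

theorem sum_lap_mulVec (G : SimpleGraph V) (x : V → ℝ) : ∑ v, (lap G *ᵥ x) v = 0 := by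
  have h := lap_dotProduct_comm G (fun _ => 1) x
  rw [lap_mulVec_const, zero_dotProduct] at h
  simpa [dotProduct] using h

theorem lap_compl_mulVec (G : SimpleGraph V) (x : V → ℝ) (v : V) :
    (lap Gᶜ *ᵥ x) v = Fintype.card V * x v - ∑ w, x w - (lap G *ᵥ x) v := by
  rw [eq_sub_iff_add_eq, lap_mulVec_apply, lap_mulVec_apply, ← Finset.sum_add_distrib,
    ← nsmul_eq_mul, ← Finset.card_univ, ← Finset.sum_const, ← Finset.sum_sub_distrib]
  refine Finset.sum_congr rfl fun w _ => ?_
  by_cases hvw : v = w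
  · simp [hvw]
  · by_cases h : G.Adj v w <;> simp [h, hvw]

theorem lap_apply_self (G : SimpleGraph V) (v : V) : lap G v v = deg G v := by
  simp [lap, deg, lapMatrix, degMatrix]

theorem trace_lap (G : SimpleGraph V) : (lap G).trace = ∑ v, (deg G v : ℝ) := by
  simp [Matrix.trace, lap_apply_self]

theorem lap_mul_self_apply_self (G : SimpleGraph V) (v : V) :
    (lap G * lap G) v v = (deg G v : ℝ) ^ 2 + deg G v := by
  have h : ∀ w, lap G v w * lap G w v =
      (if v = w then (deg G v : ℝ) ^ 2 else 0) + if G.Adj v w then 1 else 0 := by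
    intro w
    by_cases hvw : v = w
    · subst hvw
      simp [lap_apply_self, sq]
    · by_cases h : G.Adj v w
      · simp [lap, lapMatrix, degMatrix, hvw, Ne.symm hvw, h, h.symm]
      · simp [lap, lapMatrix, degMatrix, hvw, Ne.symm hvw, h]
  rw [Matrix.mul_apply, Finset.sum_congr rfl fun w _ => h w, Finset.sum_add_distrib, deg,
    degree_eq_sum_if_adj]
  simp

theorem trace_lap_mul_self (G : SimpleGraph V) :
    (lap G * lap G).trace = ∑ v, ((deg G v : ℝ) ^ 2 + deg G v) := by
  simp [Matrix.trace, lap_mul_self_apply_self]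

/-! ### Cospectral graphs and linear equivalences -/

theorem charpoly_lap (G : SimpleGraph V) :
    (lap G).charpoly = ((lapSpec G).map fun a => Polynomial.X - Polynomial.C a).prod := by
  rw [lap, (G.isHermitian_lapMatrix ℝ).charpoly_eq, lapSpec, Multiset.map_map]
  rfl

theorem lCospectral_iff_charpoly {G : SimpleGraph V} {H : SimpleGraph W} :
    LCospectral G H ↔ (lap G).charpoly = (lap H).charpoly := by
  constructor
  · intro h
    rw [charpoly_lap, charpoly_lap, show lapSpec G = lapSpec H from h]
  · intro h
    have h2 := congrArg Polynomial.roots h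
    rwa [charpoly_lap, charpoly_lap, Polynomial.roots_multiset_prod_X_sub_C,
      Polynomial.roots_multiset_prod_X_sub_C] at h2

theorem LCospectral.card_eq {G : SimpleGraph V} {H : SimpleGraph W} (h : LCospectral G H) :
    Fintype.card V = Fintype.card W := by
  have := congrArg Multiset.card (show lapSpec G = lapSpec H from h)
  simpa [lapSpec] using this

theorem lCospectral_of_linearEquiv {G : SimpleGraph V} {H : SimpleGraph W}
    (Φ : (V → ℝ) ≃ₗ[ℝ] (W → ℝ)) (h : ∀ x, Φ (lap G *ᵥ x) = lap H *ᵥ Φ x) : LCospectral G H := by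
  rw [lCospectral_iff_charpoly, ← Matrix.charpoly_toLin', ← Matrix.charpoly_toLin',
    ← LinearEquiv.charpoly_conj Φ]
  congr 1
  refine LinearMap.ext fun x => ?_
  simp [LinearEquiv.conj_apply, h]

theorem LCospectral.symm {G : SimpleGraph V} {H : SimpleGraph W} (h : LCospectral G H) :
    LCospectral H G := Eq.symm h

theorem LCospectral.trans {U : Type*} [Fintype U] {G : SimpleGraph V} {H : SimpleGraph W}
    {K : SimpleGraph U} (h : LCospectral G H) (h' : LCospectral H K) : LCospectral G K :=
  Eq.trans h h'

theorem LCospectral.of_iso {G : SimpleGraph V} {H : SimpleGraph W} (f : G ≃g H) :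
    LCospectral G H := by
  refine lCospectral_of_linearEquiv (LinearEquiv.funCongrLeft ℝ ℝ f.symm.toEquiv) fun x => ?_
  ext w
  simp only [LinearEquiv.funCongrLeft_apply, LinearMap.funLeft_apply, lap_mulVec_apply]
  refine Fintype.sum_equiv f.toEquiv _ _ fun v => ?_
  have : G.Adj (f.symm w) v ↔ H.Adj w (f v) := by
    rw [← f.map_adj_iff]; simp
  simp [this]

/-- A linear isometry that intertwines two Laplacian matrices. -/
def IsLapIsometry (G : SimpleGraph V) (H : SimpleGraph W) (Φ : (V → ℝ) ≃ₗ[ℝ] (W → ℝ)) : Prop :=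
  (∀ x y, Φ x ⬝ᵥ Φ y = x ⬝ᵥ y) ∧ ∀ x, Φ (lap G *ᵥ x) = lap H *ᵥ Φ x

/-- Both matrices diagonalise to the same `D`, so composing one orthonormal eigenbasis with the
inverse of the other gives `Q`. -/
theorem exists_orthogonal_of_charpoly_eq {A B : Matrix V V ℝ} (hA : A.IsHermitian)
    (hB : B.IsHermitian) (h : A.charpoly = B.charpoly) :
    ∃ Q : Matrix V V ℝ, Qᵀ * Q = 1 ∧ Q * Qᵀ = 1 ∧ Q * A = B * Q := by
  have he := (hA.eigenvalues_eq_eigenvalues_iff hB).2 h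
  have sA := hA.spectral_theorem
  have sB := hB.spectral_theorem
  rw [Unitary.conjStarAlgAut_apply] at sA sB
  rw [← he] at sB
  set D : Matrix V V ℝ := diagonal (RCLike.ofReal ∘ hA.eigenvalues)
  set U : Matrix V V ℝ := (hA.eigenvectorUnitary : Matrix V V ℝ)
  set S : Matrix V V ℝ := (hB.eigenvectorUnitary : Matrix V V ℝ)
  have hU1 : star U * U = 1 := Unitary.coe_star_mul_self hA.eigenvectorUnitary
  have hU2 : U * star U = 1 := Unitary.coe_mul_star_self hA.eigenvectorUnitary
  have hS1 : star S * S = 1 := Unitary.coe_star_mul_self hB.eigenvectorUnitary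
  have hS2 : S * star S = 1 := Unitary.coe_mul_star_self hB.eigenvectorUnitary
  have ht : (S * star U)ᵀ = U * star S := by
    rw [← conjTranspose_eq_transpose_of_trivial, ← star_eq_conjTranspose, star_mul, star_star]
  refine ⟨S * star U, ?_, ?_, ?_⟩
  · rw [ht, mul_assoc, ← mul_assoc (star S), hS1, one_mul, hU2]
  · rw [ht, mul_assoc, ← mul_assoc (star U), hU1, one_mul, hS2]
  · calc S * star U * A = S * (star U * U) * D * star U := by
          conv_lhs => rw [sA]
          simp only [mul_assoc, U, D]
      _ = S * D * (star S * S) * star U := by rw [hU1, hS1]; simp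
      _ = B * (S * star U) := by
          conv_rhs => rw [sB]
          simp only [mul_assoc, S]

theorem LCospectral.exists_isLapIsometry {G : SimpleGraph V} {H : SimpleGraph W}
    (h : LCospectral G H) : ∃ Φ, IsLapIsometry G H Φ := by
  let e : V ≃ W := Fintype.equivOfCardEq h.card_eq
  have hB : (reindex e.symm e.symm (lap H)).IsHermitian :=
    (H.isHermitian_lapMatrix ℝ).submatrix _
  obtain ⟨Q, h1, h2, h3⟩ := exists_orthogonal_of_charpoly_eq (A := lap G)
    (G.isHermitian_lapMatrix ℝ) hB
    (by rw [charpoly_reindex]; exact lCospectral_iff_charpoly.1 h)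
  refine ⟨(Matrix.toLin'OfInv h1 h2).trans (LinearEquiv.funCongrLeft ℝ ℝ e.symm), ?_, ?_⟩
  · intro x y
    have : ∀ z : V → ℝ, ((Matrix.toLin'OfInv h1 h2).trans (LinearEquiv.funCongrLeft ℝ ℝ e.symm)) z
        = (Q *ᵥ z) ∘ e.symm := fun z => by
      ext w; simp [LinearMap.funLeft_apply, Matrix.toLin'OfInv]
    rw [this, this, comp_equiv_dotProduct_comp_equiv, dotProduct_mulVec, ← mulVec_transpose,
      mulVec_mulVec, h1, one_mulVec]
  · intro x
    have : ∀ z : V → ℝ, ((Matrix.toLin'OfInv h1 h2).trans (LinearEquiv.funCongrLeft ℝ ℝ e.symm)) z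
        = (Q *ᵥ z) ∘ e.symm := fun z => by
      ext w; simp [LinearMap.funLeft_apply, Matrix.toLin'OfInv]
    rw [this, this, mulVec_mulVec, h3, ← mulVec_mulVec]
    rw [reindex_apply, submatrix_mulVec_equiv]
    ext w
    simp only [Function.comp_apply, Equiv.symm_symm, Equiv.apply_symm_apply]

theorem trace_eq_of_linearEquiv (Φ : (V → ℝ) ≃ₗ[ℝ] (W → ℝ)) {A : Matrix V V ℝ} {B : Matrix W W ℝ}
    (h : ∀ x, Φ (A *ᵥ x) = B *ᵥ Φ x) : A.trace = B.trace := by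
  rw [← Matrix.trace_toLin'_eq, ← Matrix.trace_toLin'_eq, ← LinearMap.trace_conj' _ Φ]
  congr 1
  refine LinearMap.ext fun x => ?_
  simp [LinearEquiv.conj_apply, h]

/-- The complement has Laplacian `N·1 - J - L`, so only the all-ones matrix `J` is at stake.
Connectedness of `H` makes the image of the all-ones vector constant, and the isometry makes that
constant square to 1. -/
theorem IsLapIsometry.compl {G : SimpleGraph V} {H : SimpleGraph W} {Φ : (V → ℝ) ≃ₗ[ℝ] (W → ℝ)}
    (h : IsLapIsometry G H Φ) (hH : H.Preconnected) : IsLapIsometry Gᶜ Hᶜ Φ := by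
  obtain ⟨h1, h2⟩ := h
  refine ⟨h1, fun x => ?_⟩
  have hcard : (Fintype.card V : ℝ) = Fintype.card W := by
    exact_mod_cast (lCospectral_of_linearEquiv Φ h2).card_eq
  have hone : ∀ i j, Φ (fun _ => 1) i = Φ (fun _ => 1) j := by
    intro i j
    refine (lap_mulVec_eq_zero_iff H _).1 ?_ i j (hH i j)
    rw [← h2, lap_mulVec_const, map_zero]
  have key : ∀ w, (∑ v, x v) * Φ (fun _ => 1) w = ∑ w, Φ x w := by
    intro w
    have e1 := h1 x (fun _ => 1)
    have e2 := h1 (fun _ => 1) (fun _ => 1)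
    rw [show Φ (fun _ => 1) = fun _ => Φ (fun _ => 1) w from funext fun j => hone j w] at e1 e2
    simp only [dotProduct, mul_one, ← Finset.sum_mul] at e1 e2
    simp only [Finset.sum_const, Finset.card_univ, nsmul_eq_mul, mul_one, hcard] at e2
    have hW : (Fintype.card W : ℝ) ≠ 0 := by
      have : 0 < Fintype.card W := Fintype.card_pos_iff.2 ⟨w⟩
      positivity
    have e3 : Φ (fun _ => 1) w * Φ (fun _ => 1) w = 1 := by
      apply mul_left_cancel₀ hW
      linarith
    rw [← e1, mul_assoc, e3, mul_one]
  have hx : lap Gᶜ *ᵥ x =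
      (Fintype.card V : ℝ) • x - (∑ w, x w) • (fun _ => (1 : ℝ)) - lap G *ᵥ x := by
    ext v
    simp [lap_compl_mulVec]
  rw [hx, map_sub, map_sub, map_smul, map_smul, h2]
  ext w
  simp [lap_compl_mulVec, key, hcard]

theorem IsLapIsometry.symm {G : SimpleGraph V} {H : SimpleGraph W} {Φ : (V → ℝ) ≃ₗ[ℝ] (W → ℝ)}
    (h : IsLapIsometry G H Φ) : IsLapIsometry H G Φ.symm := by
  refine ⟨fun x y => ?_, fun x => ?_⟩
  · rw [← h.1]; simp
  · rw [LinearEquiv.symm_apply_eq, h.2]; simp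

theorem LCospectral.sum_deg_eq {G : SimpleGraph V} {H : SimpleGraph W} (h : LCospectral G H) :
    ∑ v, deg G v = ∑ w, deg H w := by
  obtain ⟨Φ, -, h2⟩ := h.exists_isLapIsometry
  have := trace_eq_of_linearEquiv Φ h2
  rw [trace_lap, trace_lap] at this
  exact_mod_cast this

theorem LCospectral.sum_deg_sq_eq {G : SimpleGraph V} {H : SimpleGraph W} (h : LCospectral G H) :
    ∑ v, deg G v ^ 2 = ∑ w, deg H w ^ 2 := by
  have h1 := h.sum_deg_eq
  obtain ⟨Φ, -, h2⟩ := h.exists_isLapIsometry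
  have := trace_eq_of_linearEquiv Φ (A := lap G * lap G) (B := lap H * lap H) fun x => by
    rw [← mulVec_mulVec, h2, h2, mulVec_mulVec]
  rw [trace_lap_mul_self, trace_lap_mul_self] at this
  have h3 : ∑ v, (deg G v ^ 2 + deg G v) = ∑ w, (deg H w ^ 2 + deg H w) := by exact_mod_cast this
  rw [Finset.sum_add_distrib, Finset.sum_add_distrib] at h3
  omega

/-! ### The projection onto the kernel -/

/-- The number of vertices in the connected component of a vertex. -/
noncomputable def compSize (G : SimpleGraph V) (v : V) : ℕ :=
  (Finset.univ.filter (G.Reachable v)).card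

theorem compSize_pos (G : SimpleGraph V) (v : V) : 0 < compSize G v :=
  Finset.card_pos.2 ⟨v, by simp⟩

theorem compSize_congr {G : SimpleGraph V} {u v : V} (h : G.Reachable u v) :
    compSize G u = compSize G v := by
  unfold compSize
  congr 1
  ext w
  simp only [Finset.mem_filter, Finset.mem_univ, true_and]
  exact ⟨h.symm.trans, h.trans⟩

theorem deg_lt_compSize (G : SimpleGraph V) (v : V) : deg G v < compSize G v := by
  rw [deg_eq_card_filter, compSize]
  refine Finset.card_lt_card ⟨fun w => by simpa using Adj.reachable, fun h => ?_⟩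
  have : v ∈ Finset.univ.filter (G.Adj v) := h (by simp)
  simp at this

theorem compSize_eq_one_of_deg_eq_zero {G : SimpleGraph V} {v : V} (h : deg G v = 0) :
    compSize G v = 1 := by
  rw [compSize, Finset.card_eq_one]
  refine ⟨v, ?_⟩
  ext w
  simp only [Finset.mem_filter, Finset.mem_univ, true_and, Finset.mem_singleton]
  constructor
  · rintro ⟨p⟩
    cases p with
    | nil => rfl
    | cons hadj _ =>
      rw [deg_eq_card_filter, Finset.card_eq_zero] at h
      exact absurd hadj (by simpa using Finset.eq_empty_iff_forall_notMem.1 h _)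
  · rintro rfl
    rfl

/-- The matrix that averages over connected components. -/
noncomputable def avgMatrix (G : SimpleGraph V) : Matrix V V ℝ :=
  Matrix.of fun u v => if G.Reachable u v then (compSize G u : ℝ)⁻¹ else 0

theorem avgMatrix_mulVec_apply (G : SimpleGraph V) (x : V → ℝ) (v : V) :
    (avgMatrix G *ᵥ x) v = (compSize G v : ℝ)⁻¹ * ∑ w, if G.Reachable v w then x w else 0 := by
  simp only [avgMatrix, mulVec, dotProduct, of_apply, ite_mul, zero_mul, Finset.mul_sum, mul_ite,
    mul_zero]

theorem trace_avgMatrix (G : SimpleGraph V) :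
    (avgMatrix G).trace = ∑ v, (compSize G v : ℝ)⁻¹ := by
  simp [Matrix.trace, avgMatrix]

theorem lap_mulVec_avgMatrix (G : SimpleGraph V) (x : V → ℝ) :
    lap G *ᵥ (avgMatrix G *ᵥ x) = 0 := by
  rw [lap_mulVec_eq_zero_iff]
  intro i j hij
  rw [avgMatrix_mulVec_apply, avgMatrix_mulVec_apply, compSize_congr hij]
  congr 1
  refine Finset.sum_congr rfl fun w _ => ?_
  rw [if_congr ⟨hij.symm.trans, hij.trans⟩ rfl rfl]

/-- Kernel vectors are constant on components. Together with `lap_mulVec_avgMatrix` this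
characterises `avgMatrix` as the orthogonal projection onto the kernel. -/
theorem dotProduct_avgMatrix {G : SimpleGraph V} {z : V → ℝ} (hz : lap G *ᵥ z = 0) (x : V → ℝ) :
    z ⬝ᵥ (avgMatrix G *ᵥ x) = z ⬝ᵥ x := by
  rw [lap_mulVec_eq_zero_iff] at hz
  have : z ᵥ* avgMatrix G = z := by
    ext v
    have h1 : ∀ u, z u * avgMatrix G u v =
        if G.Reachable v u then z v * (compSize G v : ℝ)⁻¹ else 0 := by
      intro u
      by_cases h : G.Reachable v u
      · simp [avgMatrix, h, h.symm, hz v u h, compSize_congr h]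
      · have h' : ¬ G.Reachable u v := fun h' => h h'.symm
        simp [avgMatrix, h, h']
    have h2 : (compSize G v : ℝ) ≠ 0 := by exact_mod_cast (compSize_pos G v).ne'
    simp only [vecMul, dotProduct, h1]
    rw [← Finset.sum_filter, Finset.sum_const, nsmul_eq_mul]
    change (compSize G v : ℝ) * _ = _
    field_simp
  rw [dotProduct_mulVec, this]

theorem IsLapIsometry.map_avgMatrix {G : SimpleGraph V} {H : SimpleGraph W}
    {Φ : (V → ℝ) ≃ₗ[ℝ] (W → ℝ)} (h : IsLapIsometry G H Φ) (x : V → ℝ) :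
    Φ (avgMatrix G *ᵥ x) = avgMatrix H *ᵥ Φ x := by
  have k1 : lap H *ᵥ Φ (avgMatrix G *ᵥ x) = 0 := by rw [← h.2, lap_mulVec_avgMatrix, map_zero]
  have k2 := lap_mulVec_avgMatrix H (Φ x)
  -- The difference lies in the kernel of `lap H` and is orthogonal to that kernel, hence to itself.
  set d := Φ (avgMatrix G *ᵥ x) - avgMatrix H *ᵥ Φ x with hd
  have k3 : lap H *ᵥ d = 0 := by rw [hd, mulVec_sub, k1, k2, sub_zero]
  have k4 : d ⬝ᵥ d = 0 := by
    conv_lhs => rw [hd, dotProduct_sub]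
    rw [← hd, dotProduct_avgMatrix k3]
    have k5 : lap G *ᵥ Φ.symm d = 0 := by rw [← h.symm.2, k3, map_zero]
    have k6 := dotProduct_avgMatrix k5 x
    rw [← h.1, ← h.1] at k6
    simp only [LinearEquiv.apply_symm_apply] at k6
    rw [k6, sub_self]
  rw [dotProduct_self_eq_zero] at k4
  exact sub_eq_zero.1 k4

theorem IsLapIsometry.sum_inv_compSize_eq {G : SimpleGraph V} {H : SimpleGraph W}
    {Φ : (V → ℝ) ≃ₗ[ℝ] (W → ℝ)} (h : IsLapIsometry G H Φ) :
    ∑ v, (compSize G v : ℝ)⁻¹ = ∑ w, (compSize H w : ℝ)⁻¹ := by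
  rw [← trace_avgMatrix, ← trace_avgMatrix]
  exact trace_eq_of_linearEquiv Φ h.map_avgMatrix

theorem mulVec_single_one_apply (A : Matrix V V ℝ) (u v : V) :
    (A *ᵥ Pi.single v 1) u = A u v := by
  simp

/-- Turns a spectral gap of `H` into a local bound in `G`: the quadratic form is tested on the image
of the basis vector at `v`. -/
theorem IsLapIsometry.le_deg {G : SimpleGraph V} {H : SimpleGraph W}
    {Φ : (V → ℝ) ≃ₗ[ℝ] (W → ℝ)} (h : IsLapIsometry G H Φ) {c : ℝ}
    (hc : ∀ y, c * (y ⬝ᵥ y - y ⬝ᵥ (avgMatrix H *ᵥ y)) ≤ y ⬝ᵥ (lap H *ᵥ y)) (v : V) :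
    c * (1 - (compSize G v : ℝ)⁻¹) ≤ deg G v := by
  have := hc (Φ (Pi.single v 1))
  rw [← h.map_avgMatrix, ← h.2, h.1, h.1, h.1] at this
  simpa [lap_apply_self, avgMatrix] using this

theorem IsLapIsometry.quadratic {G : SimpleGraph V} {H : SimpleGraph W}
    {Φ : (V → ℝ) ≃ₗ[ℝ] (W → ℝ)} (h : IsLapIsometry G H Φ) {a b : ℝ}
    (hc : ∀ y, lap H *ᵥ (lap H *ᵥ y) - a • (lap H *ᵥ y) + b • (y - avgMatrix H *ᵥ y) = 0) (v : V) :
    (deg G v : ℝ) ^ 2 + deg G v - a * deg G v + b * (1 - (compSize G v : ℝ)⁻¹) = 0 := by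
  have h1 := hc (Φ (Pi.single v 1))
  rw [← h.map_avgMatrix, ← h.2, ← h.2, ← map_sub, ← map_smul, ← map_smul, ← map_sub, ← map_add,
    LinearEquiv.map_eq_zero_iff] at h1
  have h2 := congrFun h1 v
  rw [mulVec_mulVec] at h2
  simp only [Pi.add_apply, Pi.sub_apply, Pi.smul_apply, mulVec_single_one_apply,
    lap_mul_self_apply_self, lap_apply_self, smul_eq_mul, Pi.single_eq_same, Pi.zero_apply] at h2
  simpa [avgMatrix] using h2

end Laplacian

/-! ### Joins -/

section Join

variable {A B C A' B' : Type*}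

@[simp]
theorem graphProduct_adj_inl_inl (X : SimpleGraph A) (Z : SimpleGraph B) (i j : A) :
    (graphProduct X Z).Adj (.inl i) (.inl j) ↔ X.Adj i j := by
  simp [graphProduct]

@[simp]
theorem graphProduct_adj_inr_inr (X : SimpleGraph A) (Z : SimpleGraph B) (i j : B) :
    (graphProduct X Z).Adj (.inr i) (.inr j) ↔ Z.Adj i j := by
  simp [graphProduct]

@[simp]
theorem graphProduct_adj_inl_inr (X : SimpleGraph A) (Z : SimpleGraph B) (i : A) (j : B) :
    (graphProduct X Z).Adj (.inl i) (.inr j) := by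
  simp [graphProduct]

@[simp]
theorem graphProduct_adj_inr_inl (X : SimpleGraph A) (Z : SimpleGraph B) (i : A) (j : B) :
    (graphProduct X Z).Adj (.inr j) (.inl i) := by
  simp [graphProduct]

/-- Joins of isomorphic graphs are isomorphic. -/
def graphProductCongr {X : SimpleGraph A} {X' : SimpleGraph A'} {Z : SimpleGraph B}
    {Z' : SimpleGraph B'} (f : X ≃g X') (g : Z ≃g Z') :
    graphProduct X Z ≃g graphProduct X' Z' where
  toEquiv := Equiv.sumCongr f.toEquiv g.toEquiv
  map_rel_iff' := by
    rintro (a | a) (b | b) <;> simp [f.map_adj_iff, g.map_adj_iff]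

/-- The join is commutative up to isomorphism. -/
def graphProductComm (X : SimpleGraph A) (Z : SimpleGraph B) :
    graphProduct X Z ≃g graphProduct Z X where
  toEquiv := Equiv.sumComm A B
  map_rel_iff' := by
    rintro (a | a) (b | b) <;> simp

/-- The join is associative up to isomorphism. -/
def graphProductAssoc (X : SimpleGraph A) (Y : SimpleGraph B) (Z : SimpleGraph C) :
    graphProduct (graphProduct X Y) Z ≃g graphProduct X (graphProduct Y Z) where
  toEquiv := Equiv.sumAssoc A B C
  map_rel_iff' := by
    rintro ((a | a) | a) ((b | b) | b) <;> simp

/-- Graphs with isomorphic complements are isomorphic. -/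
def isoOfCompl {X : SimpleGraph A} {Z : SimpleGraph B} (f : Xᶜ ≃g Zᶜ) : X ≃g Z where
  toEquiv := f.toEquiv
  map_rel_iff' := by
    intro a b
    have h := f.map_adj_iff (v := a) (w := b)
    by_cases hab : a = b
    · simp [hab]
    · simp only [compl_adj, ne_eq, EmbeddingLike.apply_eq_iff_eq, hab, not_false_eq_true,
        true_and] at h
      exact not_iff_not.1 h

theorem nonempty_iso_graphProduct_induce (G : SimpleGraph A) (S : Set A)
    (h : ∀ a ∈ S, ∀ b ∉ S, G.Adj a b) :
    Nonempty (G ≃g graphProduct (G.induce S) (G.induce Sᶜ)) := by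
  classical
  refine ⟨Iso.symm ⟨Equiv.Set.sumCompl S, ?_⟩⟩
  rintro (⟨a, ha⟩ | ⟨a, ha⟩) (⟨b, hb⟩ | ⟨b, hb⟩)
  · simp
  · simpa using h a ha b hb
  · simpa using (h b hb a ha).symm
  · simp

theorem graphProduct_preconnected (X : SimpleGraph A) [Nonempty B] :
    (graphProduct X (⊤ : SimpleGraph B)).Preconnected := by
  obtain ⟨b⟩ := ‹Nonempty B›
  have h : ∀ v, (graphProduct X (⊤ : SimpleGraph B)).Reachable v (.inr b) := by
    rintro (i | j)
    · exact Adj.reachable (by simp)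
    · by_cases hj : j = b
      · rw [hj]
      · exact Adj.reachable (by simpa using hj)
  exact fun u v => (h u).trans (h v).symm

end Join

/-! ### Laplacians of joins and recognition of matchings and cycles -/

section JoinLaplacian

open scoped Classical
open Matrix

variable {A B : Type*} [Fintype A] [Fintype B]

theorem deg_graphProduct_inl (X : SimpleGraph A) (Z : SimpleGraph B) (i : A) :
    deg (graphProduct X Z) (.inl i) = deg X i + Fintype.card B := by
  simp only [deg_eq_card_filter, Finset.card_filter, Fintype.sum_sum_type, graphProduct_adj_inl_inl,
    graphProduct_adj_inl_inr]
  simp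

theorem deg_graphProduct_inr (X : SimpleGraph A) (Z : SimpleGraph B) (j : B) :
    deg (graphProduct X Z) (.inr j) = deg Z j + Fintype.card A := by
  simp only [deg_eq_card_filter, Finset.card_filter, Fintype.sum_sum_type, graphProduct_adj_inr_inr,
    graphProduct_adj_inr_inl]
  simp [add_comm]

theorem lap_graphProduct_mulVec_inl (X : SimpleGraph A) (Z : SimpleGraph B) (y : A ⊕ B → ℝ)
    (i : A) : (lap (graphProduct X Z) *ᵥ y) (.inl i) =
      (lap X *ᵥ (y ∘ .inl)) i + Fintype.card B * y (.inl i) - ∑ j, y (.inr j) := by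
  simp only [lap_mulVec_apply, Fintype.sum_sum_type, graphProduct_adj_inl_inl,
    graphProduct_adj_inl_inr, if_true, Finset.sum_sub_distrib, Finset.sum_const, Finset.card_univ,
    nsmul_eq_mul, Function.comp_apply]
  ring

theorem lap_graphProduct_mulVec_inr (X : SimpleGraph A) (Z : SimpleGraph B) (y : A ⊕ B → ℝ)
    (j : B) : (lap (graphProduct X Z) *ᵥ y) (.inr j) =
      (lap Z *ᵥ (y ∘ .inr)) j + Fintype.card A * y (.inr j) - ∑ i, y (.inl i) := by
  simp only [lap_mulVec_apply, Fintype.sum_sum_type, graphProduct_adj_inr_inr,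
    graphProduct_adj_inr_inl, if_true, Finset.sum_sub_distrib, Finset.sum_const, Finset.card_univ,
    nsmul_eq_mul, Function.comp_apply]
  ring

theorem lap_compl_graphProduct_mulVec_inl (X : SimpleGraph A) (Z : SimpleGraph B)
    (y : A ⊕ B → ℝ) (i : A) : (lap (graphProduct X Z)ᶜ *ᵥ y) (.inl i) =
      (lap Xᶜ *ᵥ (y ∘ .inl)) i := by
  rw [lap_compl_mulVec, lap_compl_mulVec, lap_graphProduct_mulVec_inl]
  simp only [Fintype.card_sum, Fintype.sum_sum_type, Function.comp_apply]
  push_cast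
  ring

theorem lap_compl_graphProduct_mulVec_inr (X : SimpleGraph A) (Z : SimpleGraph B)
    (y : A ⊕ B → ℝ) (j : B) : (lap (graphProduct X Z)ᶜ *ᵥ y) (.inr j) =
      (lap Zᶜ *ᵥ (y ∘ .inr)) j := by
  rw [lap_compl_mulVec, lap_compl_mulVec, lap_graphProduct_mulVec_inr]
  simp only [Fintype.card_sum, Fintype.sum_sum_type, Function.comp_apply]
  push_cast
  ring

theorem lap_bot_mulVec (x : A → ℝ) : lap (⊥ : SimpleGraph A) *ᵥ x = 0 := by
  ext v
  simp [lap_mulVec_apply]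

theorem lap_top_mulVec (x : A → ℝ) (v : A) :
    (lap (⊤ : SimpleGraph A) *ᵥ x) v = Fintype.card A * x v - ∑ w, x w := by
  have := lap_compl_mulVec (⊥ : SimpleGraph A) x v
  rwa [lap_bot_mulVec, compl_bot, Pi.zero_apply, sub_zero] at this

theorem deg_top (v : A) : deg (⊤ : SimpleGraph A) v + 1 = Fintype.card A := by
  have := deg_compl (⊤ : SimpleGraph A) v
  rw [compl_top] at this
  have h0 : deg (⊥ : SimpleGraph A) v = 0 := by simp [deg_eq_card_filter]
  omega

/-- With its partial converse below, this lets the spectrum of the join detect connectedness of `X`: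
an eigenvector for `|B|` must vanish on `B` and restrict to a kernel vector of `lap X` with sum
zero. -/
theorem eq_zero_of_lap_graphProduct_mulVec {X : SimpleGraph A} (hX : X.Preconnected) [Nonempty A]
    [Nonempty B] {y : A ⊕ B → ℝ}
    (hy : lap (graphProduct X (⊤ : SimpleGraph B)) *ᵥ y = (Fintype.card B : ℝ) • y) : y = 0 := by
  have hA : (Fintype.card A : ℝ) ≠ 0 := by exact_mod_cast Fintype.card_ne_zero
  have hB : (Fintype.card B : ℝ) ≠ 0 := by exact_mod_cast Fintype.card_ne_zero
  have hs : ∑ v, y v = 0 := by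
    have := sum_lap_mulVec (graphProduct X (⊤ : SimpleGraph B)) y
    rw [hy] at this
    simp only [Pi.smul_apply, smul_eq_mul, ← Finset.mul_sum] at this
    exact (mul_eq_zero.1 this).resolve_left hB
  rw [Fintype.sum_sum_type] at hs
  have hr : ∀ j, y (.inr j) = 0 := by
    intro j
    have := congrFun hy (.inr j)
    rw [lap_graphProduct_mulVec_inr, lap_top_mulVec] at this
    simp only [Function.comp_apply, Pi.smul_apply, smul_eq_mul] at this
    have h0 : (Fintype.card A : ℝ) * y (.inr j) = 0 := by linarith
    exact (mul_eq_zero.1 h0).resolve_left hA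
  simp only [hr, Finset.sum_const_zero, add_zero] at hs
  have hl : lap X *ᵥ (y ∘ Sum.inl) = 0 := by
    ext i
    have := congrFun hy (.inl i)
    rw [lap_graphProduct_mulVec_inl] at this
    simp only [hr, Finset.sum_const_zero, Pi.smul_apply, smul_eq_mul] at this
    rw [Pi.zero_apply]
    linarith
  rw [lap_mulVec_eq_zero_iff] at hl
  ext (i | j)
  · have h1 : ∀ k, y (.inl k) = y (.inl i) := fun k => hl k i (hX k i)
    simp only [h1, Finset.sum_const, Finset.card_univ, nsmul_eq_mul] at hs
    exact (mul_eq_zero.1 hs).resolve_left hA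
  · exact hr j

theorem preconnected_of_lap_graphProduct_mulVec {X : SimpleGraph A} {Z : SimpleGraph B}
    (h : ∀ y, lap (graphProduct X Z) *ᵥ y = (Fintype.card B : ℝ) • y → y = 0) :
    X.Preconnected := by
  intro i j
  by_contra hij
  -- The indicator of the component of `i`, scaled and shifted to have sum zero; extended by zero it
  -- is an eigenvector for `|B|`.
  let a : A → ℝ := fun k => (if X.Reachable i k then (Fintype.card A : ℝ) else 0) - compSize X i
  have ha0 : lap X *ᵥ a = 0 := by
    rw [lap_mulVec_eq_zero_iff]
    intro k l hkl
    simp only [a]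
    rw [if_congr ⟨fun h => h.trans hkl, fun h => h.trans hkl.symm⟩ rfl rfl]
  have ha1 : ∑ k, a k = 0 := by
    simp only [a, Finset.sum_sub_distrib, ← Finset.sum_filter, Finset.sum_const, nsmul_eq_mul,
      Finset.card_univ]
    rw [← compSize]
    ring
  have := h (Sum.elim a 0) (by
    ext (k | l)
    · rw [lap_graphProduct_mulVec_inl, Sum.elim_comp_inl, ha0]
      simp
    · rw [lap_graphProduct_mulVec_inr, Sum.elim_comp_inr]
      simp [ha1])
  have e1 := congrFun this (.inl i)
  have e2 := congrFun this (.inl j)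
  simp only [Sum.elim_inl, Pi.zero_apply, a, Reachable.refl, if_true, if_neg hij] at e1 e2
  have hA : (Fintype.card A : ℝ) ≠ 0 := by
    have : Nonempty A := ⟨i⟩
    exact_mod_cast Fintype.card_ne_zero
  apply hA
  linarith

/-! ### Graphs of maximum degree one -/

/-- The involution swaps the ends of each edge and fixes isolated vertices, so isomorphism of
matchings becomes conjugacy of permutations. -/
theorem exists_perm_of_deg_le_one {G : SimpleGraph A} (hG : ∀ v, deg G v ≤ 1) :
    ∃ σ : Equiv.Perm A, σ ^ 2 = 1 ∧ (∀ v w, G.Adj v w ↔ v ≠ w ∧ σ v = w) ∧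
      σ.support.card = ∑ v, deg G v := by
  have huniq : ∀ {v w w'}, G.Adj v w → G.Adj v w' → w = w' := by
    intro v w w' h h'
    have := hG v
    rw [deg_eq_card_filter, Finset.card_le_one] at this
    exact this w (by simpa using h) w' (by simpa using h')
  let f : A → A := fun v => if h : ∃ w, G.Adj v w then h.choose else v
  have hf1 : ∀ {v w}, G.Adj v w → f v = w := by
    intro v w h
    have h' : ∃ w, G.Adj v w := ⟨w, h⟩
    simp only [f, dif_pos h']
    exact huniq h'.choose_spec h
  have hf2 : ∀ {v}, (¬ ∃ w, G.Adj v w) → f v = v := fun h => dif_neg h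
  have hff : Function.Involutive f := by
    intro v
    by_cases h : ∃ w, G.Adj v w
    · obtain ⟨w, hw⟩ := h
      rw [hf1 hw, hf1 hw.symm]
    · rw [hf2 h, hf2 h]
  refine ⟨hff.toPerm f, ?_, ?_, ?_⟩
  · ext v
    simpa [sq] using hff v
  · intro v w
    refine ⟨fun h => ⟨h.ne, hf1 h⟩, fun ⟨h1, h2⟩ => ?_⟩
    by_cases h : ∃ w, G.Adj v w
    · obtain ⟨u, hu⟩ := h
      have : f v = w := h2
      rw [hf1 hu] at this
      rwa [← this]
    · exact absurd ((hf2 h).symm.trans h2) h1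
  · rw [Finset.card_eq_sum_ones, ← Finset.sum_subset (Finset.subset_univ _)]
    · refine Finset.sum_congr rfl fun v hv => ?_
      refine le_antisymm ?_ (hG v)
      rw [deg_eq_card_filter, Nat.one_le_iff_ne_zero, Finset.card_ne_zero]
      by_contra hne
      refine (Equiv.Perm.mem_support.1 hv) (hf2 ?_)
      rintro ⟨w, hw⟩
      exact hne ⟨w, by simpa using hw⟩
    · intro v _ hv
      rw [Equiv.Perm.mem_support, not_not] at hv
      rw [deg_eq_card_filter, Finset.card_eq_zero, Finset.filter_eq_empty_iff]
      intro w _ hw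
      exact hw.ne (hv.symm.trans (hf1 hw))

theorem cycleType_eq_of_sq_eq_one {σ τ : Equiv.Perm A} (hσ : σ ^ 2 = 1) (hτ : τ ^ 2 = 1)
    (h : σ.support.card = τ.support.card) : σ.cycleType = τ.cycleType := by
  have key : ∀ ρ : Equiv.Perm A, ρ ^ 2 = 1 →
      ρ.cycleType = Multiset.replicate (ρ.support.card / 2) 2 := by
    intro ρ hρ
    have h1 := Multiset.eq_replicate_card.2 (Equiv.Perm.pow_prime_eq_one_iff.1 hρ)
    have h2 := ρ.sum_cycleType
    rw [h1, Multiset.sum_replicate, smul_eq_mul] at h2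
    rw [← h2, Nat.mul_div_cancel _ two_pos]
    exact h1
  rw [key σ hσ, key τ hτ, h]

theorem nonempty_iso_of_deg_le_one {G : SimpleGraph A} {H : SimpleGraph B}
    (hcard : Fintype.card A = Fintype.card B) (hG : ∀ v, deg G v ≤ 1) (hH : ∀ v, deg H v ≤ 1)
    (h : ∑ v, deg G v = ∑ v, deg H v) : Nonempty (G ≃g H) := by
  let e : A ≃ B := Fintype.equivOfCardEq hcard
  let K : SimpleGraph A := H.comap e
  let g : K ≃g H := Iso.comap e H
  have hK : ∀ v, deg K v ≤ 1 := fun v => by rw [← deg_iso g]; exact hH _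
  have hs : ∑ v, deg K v = ∑ v, deg H v :=
    Fintype.sum_equiv e _ _ fun v => (deg_iso g v).symm
  obtain ⟨σ, hσ1, hσ2, hσ3⟩ := exists_perm_of_deg_le_one hG
  obtain ⟨τ, hτ1, hτ2, hτ3⟩ := exists_perm_of_deg_le_one hK
  have hc := Equiv.Perm.isConj_iff_cycleType_eq.2
    (cycleType_eq_of_sq_eq_one hσ1 hτ1 (by rw [hσ3, hτ3, hs, h]))
  obtain ⟨c, hc⟩ := isConj_iff.1 hc
  refine ⟨RelIso.trans (⟨c, ?_⟩ : G ≃g K) g⟩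
  intro a b
  rw [hσ2, hτ2, ← hc]
  simp

/-! ### Connected two-regular graphs -/

/-- A cycle walk through a whole component is Hamiltonian by connectedness. The resulting bijective
copy of the cycle graph reflects adjacency because both graphs are 2-regular. -/
theorem nonempty_iso_cycleGraph {X : SimpleGraph A} (hdeg : ∀ v, deg X v = 2)
    (hX : X.Preconnected) {n : ℕ} (hn : 3 ≤ n) (hcard : Fintype.card A = n) :
    Nonempty (X ≃g cycleGraph n) := by
  have hne : Nonempty A := Fintype.card_pos_iff.1 (by omega)
  obtain ⟨v⟩ := hne
  have hnc : ∀ v, (X.neighborSet v).ncard = 2 := by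
    intro v
    rw [← hdeg v, deg, ← card_neighborFinset_eq_degree, Set.ncard_eq_toFinset_card']
    rfl
  have hcyc : X.IsCycles := fun v _ => hnc v
  obtain ⟨p, hp1, hp2⟩ := hcyc.exists_cycle_toSubgraph_verts_eq_connectedComponentSupp
    (c := X.connectedComponentMk v) (v := v) rfl
    (Set.nonempty_of_ncard_ne_zero (by rw [hnc]; norm_num))
  have hsupp : ∀ w, w ∈ p.support := by
    intro w
    rw [← Walk.mem_verts_toSubgraph, hp2]
    exact ConnectedComponent.sound (hX w v)
  have hlen : p.length = n := by
    have h1 : p.support.tail.toFinset = Finset.univ := by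
      ext w
      simp only [List.mem_toFinset, Finset.mem_univ, iff_true]
      have := hsupp w
      rw [Walk.mem_support_iff] at this
      rcases this with rfl | h
      · exact Walk.end_mem_tail_support hp1.not_nil
      · exact h
    have h2 := List.toFinset_card_of_nodup hp1.support_nodup
    rw [h1, Finset.card_univ, hcard, List.length_tail, Walk.length_support] at h2
    omega
  obtain ⟨f⟩ := (cycleGraph_isContained_iff (G := X) (by omega)).2 ⟨v, p, hp1, hlen⟩
  have hbij : Function.Bijective f :=
    (Fintype.bijective_iff_injective_and_card f).2 ⟨f.injective, by simp [hcard]⟩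
  have hdc : ∀ i, deg (cycleGraph n) i = 2 := by
    obtain ⟨k, rfl⟩ := Nat.exists_eq_add_of_le' hn
    intro i
    rw [deg_eq_degree, cycleGraph_degree_three_le]
  refine ⟨Iso.symm ⟨Equiv.ofBijective f hbij, ?_⟩⟩
  intro i j
  refine ⟨fun h => ?_, fun h => f.toHom.map_adj h⟩
  have himg : (Finset.univ.filter ((cycleGraph n).Adj i)).image f =
      Finset.univ.filter (X.Adj (f i)) := by
    refine Finset.eq_of_subset_of_card_le ?_ ?_
    · intro w hw
      simp only [Finset.mem_image, Finset.mem_filter, Finset.mem_univ, true_and] at hw ⊢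
      obtain ⟨k, hk, rfl⟩ := hw
      exact f.toHom.map_adj hk
    · have hinj : Function.Injective f := hbij.1
      have hci : (Finset.univ.filter ((cycleGraph n).Adj i)).card = 2 := by
        rw [← hdc i, deg_eq_card_filter]
        congr!
      rw [Finset.card_image_of_injective _ hinj, hci, ← deg_eq_card_filter, hdeg]
  have : f j ∈ Finset.univ.filter (X.Adj (f i)) := by simpa using h
  rw [← himg] at this
  simp only [Finset.mem_image, Finset.mem_filter, Finset.mem_univ, true_and] at this
  obtain ⟨k, hk, hkj⟩ := this
  rwa [← f.injective hkj]

end JoinLaplacian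

/-! ### Component sizes forced by the numerical constraints -/

section Components

open scoped Classical
open Matrix

variable {V : Type*} [Fintype V]

theorem sum_reachable_one_sub_inv_compSize (G : SimpleGraph V) (u : V) :
    ∑ v ∈ Finset.univ.filter (G.Reachable u), (1 - (compSize G v : ℝ)⁻¹) = compSize G u - 1 := by
  have h : ∀ v ∈ Finset.univ.filter (G.Reachable u),
      (1 - (compSize G v : ℝ)⁻¹) = 1 - (compSize G u : ℝ)⁻¹ := by
    intro v hv
    rw [compSize_congr (Finset.mem_filter.1 hv).2]
  have h0 : (compSize G u : ℝ) ≠ 0 := by exact_mod_cast (compSize_pos G u).ne'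
  rw [Finset.sum_congr rfl h, Finset.sum_const, nsmul_eq_mul, ← compSize, mul_sub,
    mul_inv_cancel₀ h0, mul_one]

/-- Each component of size `s` contributes `s - 1` to the right side, and `T` meets each component
at most once. -/
theorem sum_compSize_sub_one_le (G : SimpleGraph V) (T : Finset V)
    (hT : (T : Set V).Pairwise fun a b => ¬ G.Reachable a b) :
    ∑ t ∈ T, ((compSize G t : ℝ) - 1) ≤ ∑ v, (1 - (compSize G v : ℝ)⁻¹) := by
  rw [Finset.sum_congr rfl fun t _ => (sum_reachable_one_sub_inv_compSize G t).symm,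
    ← Finset.sum_biUnion]
  · refine Finset.sum_le_sum_of_subset_of_nonneg (Finset.subset_univ _) fun v _ _ => ?_
    have : (1 : ℝ) ≤ compSize G v := by exact_mod_cast compSize_pos G v
    exact sub_nonneg.2 (inv_le_one_of_one_le₀ this)
  · intro a ha b hb hab
    rw [Function.onFun, Finset.disjoint_left]
    intro v hv hv'
    exact hT ha hb hab ((Finset.mem_filter.1 hv).2.trans (Finset.mem_filter.1 hv').2.symm)

theorem compSize_add_le_two {G : SimpleGraph V} {n : ℕ}
    (h : ∑ v, (1 - (compSize G v : ℝ)⁻¹) = n - 1) {a b : V} (hab : ¬ G.Reachable a b) :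
    compSize G a + compSize G b ≤ n + 1 := by
  have hne : a ≠ b := fun h' => hab (h' ▸ Reachable.refl _)
  have := sum_compSize_sub_one_le G {a, b} (by
    rw [Finset.coe_pair, Set.pairwise_pair]
    exact fun _ => ⟨hab, fun h' => hab h'.symm⟩)
  rw [Finset.sum_pair hne, h] at this
  have h2 : (compSize G a : ℝ) + compSize G b ≤ n + 1 := by linarith
  exact_mod_cast h2

theorem compSize_add_le_three {G : SimpleGraph V} {n : ℕ}
    (h : ∑ v, (1 - (compSize G v : ℝ)⁻¹) = n - 1) {a b c : V} (hab : ¬ G.Reachable a b)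
    (hac : ¬ G.Reachable a c) (hbc : ¬ G.Reachable b c) :
    compSize G a + compSize G b + compSize G c ≤ n + 2 := by
  have nab : a ≠ b := fun h' => hab (h' ▸ Reachable.refl _)
  have nac : a ≠ c := fun h' => hac (h' ▸ Reachable.refl _)
  have nbc : b ≠ c := fun h' => hbc (h' ▸ Reachable.refl _)
  have := sum_compSize_sub_one_le G {a, b, c} (by
    intro x hx y hy hxy
    simp only [Finset.coe_insert, Finset.coe_singleton, Set.mem_insert_iff,
      Set.mem_singleton_iff] at hx hy
    rcases hx with rfl | rfl | rfl <;> rcases hy with rfl | rfl | rfl <;>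
      first
      | exact absurd rfl hxy
      | assumption
      | exact fun h' => hab h'.symm
      | exact fun h' => hac h'.symm
      | exact fun h' => hbc h'.symm)
  rw [Finset.sum_insert (by simp [nab, nac]), Finset.sum_pair nbc, h] at this
  have h2 : (compSize G a : ℝ) + compSize G b + compSize G c ≤ n + 2 := by linarith
  exact_mod_cast h2

theorem exists_compSize_eq_or_of_six_le {G : SimpleGraph V} {n : ℕ} (hn : 6 ≤ n)
    (h1 : ∑ v, deg G v = n * (n - 3)) (h2 : ∑ v, deg G v ^ 2 = n * (n - 3) ^ 2)
    (h3 : ∑ v, (1 - (compSize G v : ℝ)⁻¹) = n - 1)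
    (h4 : ∀ v, ((n : ℝ) - 4) * (1 - (compSize G v : ℝ)⁻¹) ≤ deg G v) :
    (∃ u, compSize G u = n ∧ ∀ v, ¬ G.Reachable u v → deg G v = 0) ∨
    (n = 6 ∧ ∃ u t, ¬ G.Reachable u t ∧ compSize G u = 5 ∧ compSize G t = 2 ∧
      ∀ v, ¬ G.Reachable u v → ¬ G.Reachable t v → deg G v = 0) := by
  obtain ⟨k, rfl⟩ : ∃ k, n = k + 3 := ⟨n - 3, by omega⟩
  rw [Nat.add_sub_cancel] at h1 h2
  -- Otherwise `∑ d² ≤ (k-1) ∑ d`, whereas the hypotheses give `∑ d² = k ∑ d` with `∑ d > 0`.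
  obtain ⟨u, hu⟩ : ∃ u, k ≤ deg G u := by
    by_contra! hlt
    have a1 : ∑ v, deg G v ^ 2 ≤ ∑ v, (k - 1) * deg G v := by
      refine Finset.sum_le_sum fun v _ => ?_
      rw [sq]
      exact Nat.mul_le_mul_right _ (by have := hlt v; omega)
    rw [← Finset.mul_sum, h1, h2] at a1
    obtain ⟨j, rfl⟩ : ∃ j, k = j + 1 := ⟨k - 1, by omega⟩
    rw [Nat.add_sub_cancel] at a1
    nlinarith
  have hsu : k + 1 ≤ compSize G u := by have := deg_lt_compSize G u; omega
  by_cases ht : ∃ t, ¬ G.Reachable u t ∧ 2 ≤ compSize G t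
  · right
    obtain ⟨t, hut, hst⟩ := ht
    have hsum := compSize_add_le_two h3 hut
    have hu2 : compSize G u = k + 2 := by
      by_contra hne
      have hsu1 : compSize G u = k + 1 := by omega
      have hdeg : ∀ v, deg G v ≤ k := by
        intro v
        by_cases huv : G.Reachable u v
        · have a1 := deg_lt_compSize G v
          rw [← compSize_congr huv] at a1
          omega
        · have a1 := deg_lt_compSize G v
          have a2 := compSize_add_le_two h3 huv
          omega
      -- With all degrees at most `k`, equality `∑ d² = k ∑ d` leaves only degrees 0 and `k`. But
      -- `t` is not isolated, and its component has at most three vertices, so its degree is below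
      -- `k`.
      have hz : ∑ v, deg G v * (k - deg G v) = 0 := by
        have a1 : ∑ v, (deg G v * (k - deg G v) + deg G v ^ 2) = ∑ v, k * deg G v := by
          refine Finset.sum_congr rfl fun v _ => ?_
          obtain ⟨j, hj⟩ := Nat.exists_eq_add_of_le (hdeg v)
          rw [show k - deg G v = j by omega]
          conv_rhs => rw [hj]
          ring
        rw [Finset.sum_add_distrib, h2, ← Finset.mul_sum, h1] at a1
        have : (k + 3) * k ^ 2 = k * ((k + 3) * k) := by ring
        omega
      have hzt := (Finset.sum_eq_zero_iff.1 hz) t (Finset.mem_univ t)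
      have hdt := deg_lt_compSize G t
      rcases Nat.mul_eq_zero.1 hzt with h0 | h0
      · have := compSize_eq_one_of_deg_eq_zero h0
        omega
      · omega
    have ht2 : compSize G t = 2 := by omega
    -- In a component of size 2 the gap inequality reads `(k-1)/2 ≤ 1`.
    have hk : k = 3 := by
      have a1 := h4 t
      have a2 : deg G t ≤ 1 := by have := deg_lt_compSize G t; omega
      have a3 : (deg G t : ℝ) ≤ 1 := by exact_mod_cast a2
      rw [ht2] at a1
      push_cast at a1
      have a4 : (k : ℝ) ≤ 3 := by linarith
      have a5 : k ≤ 3 := by exact_mod_cast a4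
      omega
    subst hk
    refine ⟨rfl, u, t, hut, hu2, ht2, fun v huv htv => ?_⟩
    have a1 := compSize_add_le_three h3 hut huv htv
    have a2 := deg_lt_compSize G v
    omega
  · left
    push Not at ht
    refine ⟨u, ?_, fun v hv => ?_⟩
    · have a1 : ∑ v, (1 - (compSize G v : ℝ)⁻¹) = compSize G u - 1 := by
        rw [← sum_reachable_one_sub_inv_compSize]
        refine (Finset.sum_subset (Finset.subset_univ _) fun v _ hv => ?_).symm
        have hv' : ¬ G.Reachable u v := by simpa using hv
        have a2 : compSize G v = 1 := by
          have := ht v hv'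
          have := compSize_pos G v
          omega
        simp [a2]
      rw [h3] at a1
      have a2 : ((k + 3 : ℕ) : ℝ) = compSize G u := by linarith
      exact_mod_cast a2.symm
    · have := ht v hv
      have := deg_lt_compSize G v
      omega

theorem exists_compSize_eq_five {G : SimpleGraph V}
    (h3 : ∑ v, (1 - (compSize G v : ℝ)⁻¹) = 5 - 1)
    (h4 : ∀ v, (deg G v : ℝ) ^ 2 + deg G v - 5 * deg G v + 5 * (1 - (compSize G v : ℝ)⁻¹) = 0) :
    ∃ u, compSize G u = 5 ∧ ∀ v, ¬ G.Reachable u v → deg G v = 0 := by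
  have hs : ∀ v, compSize G v = 1 ∨ compSize G v = 5 := by
    intro v
    have h0 : (compSize G v : ℝ) ≠ 0 := by exact_mod_cast (compSize_pos G v).ne'
    have a1 := h4 v
    field_simp at a1
    -- Completing the square turns the quadratic relation into a divisibility of the prime 5.
    have a2 : ((compSize G v : ℤ) : ℝ) * (((deg G v : ℤ) - 2) ^ 2 + 1) = 5 := by
      push_cast
      linarith
    have a3 : (compSize G v : ℤ) * (((deg G v : ℤ) - 2) ^ 2 + 1) = 5 := by exact_mod_cast a2
    have a4 : (compSize G v : ℤ) ∣ (5 : ℕ) := Dvd.intro _ a3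
    exact (Nat.dvd_prime (by norm_num)).1 (Int.natCast_dvd_natCast.1 a4)
  obtain ⟨u, hu⟩ : ∃ u, compSize G u = 5 := by
    by_contra! hne
    have a1 : ∀ v, compSize G v = 1 := fun v => (hs v).resolve_right (hne v)
    simp only [a1, Nat.cast_one, inv_one, sub_self, Finset.sum_const_zero] at h3
    norm_num at h3
  refine ⟨u, hu, fun v hv => ?_⟩
  have a1 := compSize_add_le_two (n := 5) (by exact_mod_cast h3) hv
  have a2 := deg_lt_compSize G v
  rcases hs v with h | h <;> omega

end Components

/-! ### The complement of the join of a cycle and a complete graph -/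

section CycleJoin

open scoped Classical
open Matrix

variable {A B : Type*} [Fintype A] [Fintype B]

theorem deg_cycleGraph {n : ℕ} (hn : 3 ≤ n) (i : Fin n) : deg (cycleGraph n) i = 2 := by
  obtain ⟨k, rfl⟩ := Nat.exists_eq_add_of_le' hn
  rw [deg_eq_degree, cycleGraph_degree_three_le]

theorem deg_compl_graphProduct_inl (X : SimpleGraph A) (Z : SimpleGraph B) (i : A) :
    deg (graphProduct X Z)ᶜ (.inl i) = deg Xᶜ i := by
  have h1 := deg_compl (graphProduct X Z) (.inl i)
  have h2 := deg_compl X i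
  rw [deg_graphProduct_inl, Fintype.card_sum] at h1
  omega

theorem deg_compl_graphProduct_inr (X : SimpleGraph A) (Z : SimpleGraph B) (j : B) :
    deg (graphProduct X Z)ᶜ (.inr j) = deg Zᶜ j := by
  have h1 := deg_compl (graphProduct X Z) (.inr j)
  have h2 := deg_compl Z j
  rw [deg_graphProduct_inr, Fintype.card_sum] at h1
  omega

theorem deg_bot (v : A) : deg (⊥ : SimpleGraph A) v = 0 := by simp [deg_eq_card_filter]

theorem dotProduct_lap_le {X : SimpleGraph A} {d : ℕ} (hX : ∀ v, deg X v = d) (x : A → ℝ) :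
    x ⬝ᵥ (lap X *ᵥ x) ≤ 2 * d * (x ⬝ᵥ x) := by
  have h1 : ∑ i, ∑ j, (if X.Adj i j then (x i - x j) ^ 2 else 0) ≤
      ∑ i, ∑ j, (if X.Adj i j then 2 * x i ^ 2 else 0) +
      ∑ i, ∑ j, (if X.Adj i j then 2 * x j ^ 2 else 0) := by
    rw [← Finset.sum_add_distrib]
    refine Finset.sum_le_sum fun i _ => ?_
    rw [← Finset.sum_add_distrib]
    refine Finset.sum_le_sum fun j _ => ?_
    split_ifs
    · nlinarith [sq_nonneg (x i + x j)]
    · simp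
  have h2 : ∑ i, ∑ j, (if X.Adj i j then 2 * x i ^ 2 else 0) = 2 * d * (x ⬝ᵥ x) := by
    rw [dotProduct, Finset.mul_sum]
    refine Finset.sum_congr rfl fun i _ => ?_
    rw [← Finset.sum_filter, Finset.sum_const, ← deg_eq_card_filter, hX, nsmul_eq_mul]
    ring
  have h3 : ∑ i, ∑ j, (if X.Adj i j then 2 * x j ^ 2 else 0) = 2 * d * (x ⬝ᵥ x) := by
    rw [Finset.sum_comm, ← h2]
    exact Finset.sum_congr rfl fun i _ => Finset.sum_congr rfl fun j _ =>
      if_congr (X.adj_comm _ _) rfl rfl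
  rw [lap_dotProduct_self]
  linarith

/-- On vectors of sum zero the complement's Laplacian is `|A| - lap X`, and `lap X ≤ 2d` as a
quadratic form. Subtracting the mean `c` reduces to that case. -/
theorem le_dotProduct_lap_compl {X : SimpleGraph A} {d : ℕ} (hX : ∀ v, deg X v = d) [Nonempty A]
    (x : A → ℝ) : ((Fintype.card A : ℝ) - 2 * d) *
      (x ⬝ᵥ x - (Fintype.card A : ℝ)⁻¹ * (∑ i, x i) ^ 2) ≤ x ⬝ᵥ (lap Xᶜ *ᵥ x) := by
  have hA : (Fintype.card A : ℝ) ≠ 0 := by exact_mod_cast Fintype.card_ne_zero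
  set c : ℝ := (Fintype.card A : ℝ)⁻¹ * ∑ i, x i with hc
  have hcs : (Fintype.card A : ℝ) * c = ∑ i, x i := by rw [hc]; field_simp
  have h1 := dotProduct_lap_le hX (x - fun _ => c)
  have h2 : (x - fun _ => c) ⬝ᵥ (lap X *ᵥ (x - fun _ => c)) = x ⬝ᵥ (lap X *ᵥ x) := by
    rw [mulVec_sub, lap_mulVec_const, sub_zero, sub_dotProduct, lap_dotProduct_comm,
      lap_dotProduct_comm, lap_mulVec_const, zero_dotProduct, sub_zero]
  have h3 : (x - fun _ => c) ⬝ᵥ (x - fun _ => c) =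
      x ⬝ᵥ x - (Fintype.card A : ℝ)⁻¹ * (∑ i, x i) ^ 2 := by
    have e1 : x ⬝ᵥ (fun _ => c) = (∑ i, x i) * c := by
      rw [dotProduct, Finset.sum_mul]
    have e2 : (fun _ : A => c) ⬝ᵥ (fun _ => c) = Fintype.card A * c * c := by
      simp [dotProduct, mul_assoc]
    have e3 : (∑ i, x i) * c = (Fintype.card A : ℝ)⁻¹ * (∑ i, x i) ^ 2 := by rw [hc]; ring
    rw [sub_dotProduct, dotProduct_sub, dotProduct_sub, dotProduct_comm (fun _ => c) x, e1, e2, hcs,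
      e3]
    ring
  have h4 : x ⬝ᵥ (lap Xᶜ *ᵥ x) =
      Fintype.card A * (x ⬝ᵥ x) - (∑ i, x i) ^ 2 - x ⬝ᵥ (lap X *ᵥ x) := by
    simp only [dotProduct, lap_compl_mulVec, mul_sub, Finset.sum_sub_distrib, ← Finset.sum_mul]
    rw [sq]
    congr 2
    rw [Finset.mul_sum]
    exact Finset.sum_congr rfl fun i _ => by ring
  rw [h2, h3] at h1
  rw [h4]
  have h5 : (Fintype.card A : ℝ) * (x ⬝ᵥ x - (Fintype.card A : ℝ)⁻¹ * (∑ i, x i) ^ 2) =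
      Fintype.card A * (x ⬝ᵥ x) - (∑ i, x i) ^ 2 := by field_simp
  linarith

/-- Two adjacent vertices have at most four neighbours between them, so a fifth vertex is joined to
both in the complement. -/
theorem preconnected_compl_of_deg_eq_two {X : SimpleGraph A} (hX : ∀ v, deg X v = 2)
    (hA : 5 ≤ Fintype.card A) : Xᶜ.Preconnected := by
  intro a b
  by_cases hab : a = b
  · rw [hab]
  by_cases hadj : X.Adj a b
  · have hcard : (Finset.univ.filter (X.Adj a) ∪ Finset.univ.filter (X.Adj b)).card <
        Fintype.card A := by
      refine (Finset.card_union_le _ _).trans_lt ?_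
      rw [← deg_eq_card_filter, ← deg_eq_card_filter, hX, hX]
      omega
    obtain ⟨c, hc⟩ : ∃ c, c ∉ Finset.univ.filter (X.Adj a) ∪ Finset.univ.filter (X.Adj b) := by
      by_contra! h
      rw [Finset.eq_univ_of_forall h, Finset.card_univ] at hcard
      exact lt_irrefl _ hcard
    simp only [Finset.mem_union, Finset.mem_filter, Finset.mem_univ, true_and, not_or] at hc
    have h1 : Xᶜ.Adj a c := ⟨fun h => hc.2 (h ▸ hadj.symm), hc.1⟩
    have h2 : Xᶜ.Adj b c := ⟨fun h => hc.1 (h ▸ hadj), hc.2⟩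
    exact h1.reachable.trans h2.reachable.symm
  · exact Adj.reachable (G := Xᶜ) ⟨hab, hadj⟩

variable {X : SimpleGraph A}

theorem compSize_compl_graphProduct_top_inr (X : SimpleGraph A) (j : B) :
    compSize (graphProduct X (⊤ : SimpleGraph B))ᶜ (.inr j) = 1 := by
  apply compSize_eq_one_of_deg_eq_zero
  rw [deg_compl_graphProduct_inr, compl_top, deg_bot]

omit [Fintype A] [Fintype B] in
theorem reachable_compl_graphProduct_inl (hX : Xᶜ.Preconnected) (Z : SimpleGraph B) (i j : A) :
    (graphProduct X Z)ᶜ.Reachable (.inl i) (.inl j) := by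
  let f : Xᶜ →g (graphProduct X Z)ᶜ := ⟨Sum.inl, by
    intro a b h
    simpa using h⟩
  exact (hX i j).map f

theorem not_reachable_compl_graphProduct {X : SimpleGraph A} {Z : SimpleGraph B} {i : A} {j : B} :
    ¬ (graphProduct X Z)ᶜ.Reachable (.inl i) (.inr j) := by
  intro h
  have h0 : lap (graphProduct X Z)ᶜ *ᵥ (Sum.elim (fun _ => 0) fun _ => 1) = 0 := by
    ext (k | k)
    · rw [lap_compl_graphProduct_mulVec_inl, Sum.elim_comp_inl, lap_mulVec_const]
      rfl
    · rw [lap_compl_graphProduct_mulVec_inr, Sum.elim_comp_inr, lap_mulVec_const]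
      rfl
  have := (lap_mulVec_eq_zero_iff _ _).1 h0 _ _ h
  simp at this

theorem compSize_compl_graphProduct_inl (hX : Xᶜ.Preconnected) (Z : SimpleGraph B) (i : A) :
    compSize (graphProduct X Z)ᶜ (.inl i) = Fintype.card A := by
  rw [compSize, Finset.card_filter, Fintype.sum_sum_type]
  simp [reachable_compl_graphProduct_inl hX, not_reachable_compl_graphProduct]

theorem sum_one_sub_inv_compSize_compl_graphProduct_top (hX : Xᶜ.Preconnected) [Nonempty A] :
    ∑ v, (1 - (compSize (graphProduct X (⊤ : SimpleGraph B))ᶜ v : ℝ)⁻¹) =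
      Fintype.card A - 1 := by
  have hA : (Fintype.card A : ℝ) ≠ 0 := by exact_mod_cast Fintype.card_ne_zero
  simp only [Fintype.sum_sum_type, compSize_compl_graphProduct_top_inr,
    compSize_compl_graphProduct_inl hX, Nat.cast_one, inv_one, sub_self, Finset.sum_const_zero,
    add_zero, Finset.sum_const, Finset.card_univ, nsmul_eq_mul]
  field_simp

theorem avgMatrix_compl_graphProduct_mulVec_inl (hX : Xᶜ.Preconnected) (Z : SimpleGraph B)
    (y : A ⊕ B → ℝ) (i : A) : (avgMatrix (graphProduct X Z)ᶜ *ᵥ y) (.inl i) =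
      (Fintype.card A : ℝ)⁻¹ * ∑ k, y (.inl k) := by
  rw [avgMatrix_mulVec_apply, compSize_compl_graphProduct_inl hX, Fintype.sum_sum_type]
  simp [reachable_compl_graphProduct_inl hX, not_reachable_compl_graphProduct]

theorem avgMatrix_compl_graphProduct_mulVec_inr (y : A ⊕ B → ℝ) (j : B) :
    (avgMatrix (graphProduct X (⊤ : SimpleGraph B))ᶜ *ᵥ y) (.inr j) = y (.inr j) := by
  have h1 := compSize_compl_graphProduct_top_inr X j
  rw [avgMatrix_mulVec_apply, h1]
  rw [compSize, Finset.card_eq_one] at h1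
  obtain ⟨a, ha⟩ := h1
  have h2 : Sum.inr j = a := by
    rw [← Finset.mem_singleton, ← ha]
    simp
  have h3 : ∀ w, (graphProduct X (⊤ : SimpleGraph B))ᶜ.Reachable (.inr j) w → w = .inr j := by
    intro w hw
    rw [h2, ← Finset.mem_singleton, ← ha]
    simpa using hw
  rw [Finset.sum_eq_single (Sum.inr j)]
  · simp
  · exact fun w _ hw => if_neg fun h => hw (h3 w h)
  · simp

theorem le_dotProduct_lap_compl_graphProduct_top {d : ℕ} (hd : ∀ v, deg X v = d)
    (hX : Xᶜ.Preconnected) [Nonempty A] (y : A ⊕ B → ℝ) :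
    ((Fintype.card A : ℝ) - 2 * d) *
      (y ⬝ᵥ y - y ⬝ᵥ (avgMatrix (graphProduct X (⊤ : SimpleGraph B))ᶜ *ᵥ y)) ≤
      y ⬝ᵥ (lap (graphProduct X (⊤ : SimpleGraph B))ᶜ *ᵥ y) := by
  have h := le_dotProduct_lap_compl hd (y ∘ Sum.inl)
  simp only [dotProduct, Fintype.sum_sum_type, lap_compl_graphProduct_mulVec_inl,
    lap_compl_graphProduct_mulVec_inr, compl_top, lap_bot_mulVec,
    avgMatrix_compl_graphProduct_mulVec_inl hX, avgMatrix_compl_graphProduct_mulVec_inr,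
    ← Finset.sum_mul, Function.comp_apply, Pi.zero_apply, mul_zero, Finset.sum_const_zero,
    add_zero] at h ⊢
  refine le_trans (le_of_eq ?_) h
  ring

theorem lap_cycleGraph_five_mulVec (x : Fin 5 → ℝ) (i : Fin 5) :
    (lap (cycleGraph 5) *ᵥ x) i = 2 * x i - x (i - 1) - x (i + 1) := by
  have h : lap (cycleGraph 5) = (cycleGraph 5).lapMatrix ℝ := by
    unfold lap
    congr!
  have hne : i - 1 ≠ i + 1 := by revert i; decide
  rw [h, lapMatrix_mulVec_apply, cycleGraph_degree_three_le (n := 2), cycleGraph_neighborFinset,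
    Finset.sum_pair hne]
  push_cast
  ring

/-- The nonzero eigenvalues are `(5 ± √5)/2`, with sum 5 and product 5. -/
theorem lap_compl_cycleGraph_five_quadratic (x : Fin 5 → ℝ) (i : Fin 5) :
    (lap (cycleGraph 5)ᶜ *ᵥ (lap (cycleGraph 5)ᶜ *ᵥ x)) i - 5 * (lap (cycleGraph 5)ᶜ *ᵥ x) i
      + 5 * (x i - (5 : ℝ)⁻¹ * ∑ k, x k) = 0 := by
  have h : ∀ z : Fin 5 → ℝ, lap (cycleGraph 5)ᶜ *ᵥ z =
      fun i => 5 * z i - ∑ w, z w - (2 * z i - z (i - 1) - z (i + 1)) := by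
    intro z
    ext j
    rw [lap_compl_mulVec, lap_cycleGraph_five_mulVec]
    simp
  rw [h, h]
  simp only [Fin.sum_univ_five]
  have e1 : (-1 : Fin 5) = 4 := rfl
  have e2 : (4 : Fin 5) - 1 = 3 := rfl
  fin_cases i <;> simp [e1, e2] <;> ring

end CycleJoin

/-! ### Graphs cospectral with the join of a cycle and a complete graph -/

section Determined

open scoped Classical
open Matrix

variable {V A B : Type*} [Fintype V] [Fintype A] [Fintype B]

theorem le_one_of_sum_sq_eq {f : A → ℕ} (h : ∑ v, f v ^ 2 = ∑ v, f v) (v : A) : f v ≤ 1 := by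
  have h1 : ∀ v ∈ Finset.univ, f v ≤ f v ^ 2 := fun v _ => Nat.le_self_pow two_ne_zero _
  have h2 := (Finset.sum_eq_sum_iff_of_le h1).1 h.symm v (Finset.mem_univ v)
  nlinarith

theorem not_adj_of_deg_eq_zero {G : SimpleGraph V} {v : V} (h : deg G v = 0) (w : V) :
    ¬ G.Adj v w := by
  rw [deg_eq_card_filter, Finset.card_eq_zero, Finset.filter_eq_empty_iff] at h
  exact h (Finset.mem_univ w)

theorem deg_compl_induce {G : SimpleGraph V} {S : Set V} (h : ∀ a ∈ S, ∀ b ∉ S, G.Adj a b)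
    [inst : Fintype S] (v : S) : deg (G.induce S)ᶜ v = deg Gᶜ v := by
  obtain rfl : inst = Subtype.fintype _ := Subsingleton.elim _ _
  have h1 : (G.induce S)ᶜ = Gᶜ.induce S := by
    ext a b
    simp [Subtype.ext_iff]
  rw [h1, deg_eq_degree Gᶜ, ← degree_induce_of_neighborSet_subset (s := S) (G := Gᶜ) (v := v),
    deg_eq_degree]
  intro w hw
  by_contra hwS
  exact hw.2 (h v v.2 w hwS)

theorem deg_compl_cycleGraph {n : ℕ} (hn : 3 ≤ n) (i : Fin n) :
    deg (cycleGraph n)ᶜ i = n - 3 := by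
  have h1 := deg_compl (cycleGraph n) i
  rw [deg_cycleGraph hn, Fintype.card_fin] at h1
  omega

theorem sum_deg_compl_cycleGraph_join {n m : ℕ} (hn : 3 ≤ n) :
    ∑ v, deg (graphProduct (cycleGraph n) (completeGraph (Fin m)))ᶜ v = n * (n - 3) := by
  simp [Fintype.sum_sum_type, deg_compl_graphProduct_inl, deg_compl_graphProduct_inr,
    deg_compl_cycleGraph hn, deg_bot]

theorem sum_deg_sq_compl_cycleGraph_join {n m : ℕ} (hn : 3 ≤ n) :
    ∑ v, deg (graphProduct (cycleGraph n) (completeGraph (Fin m)))ᶜ v ^ 2 = n * (n - 3) ^ 2 := by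
  simp [Fintype.sum_sum_type, deg_compl_graphProduct_inl, deg_compl_graphProduct_inr,
    deg_compl_cycleGraph hn, deg_bot]

theorem nonempty_iso_cycleGraph_of_lCospectral_join [Nonempty B] {X : SimpleGraph A} {n m : ℕ}
    (hn : 3 ≤ n) (hA : Fintype.card A = n) (hB : Fintype.card B = m)
    (h : LCospectral (graphProduct X (⊤ : SimpleGraph B))
      (graphProduct (cycleGraph n) (completeGraph (Fin m)))) : Nonempty (X ≃g cycleGraph n) := by
  have hneA : Nonempty A := Fintype.card_pos_iff.1 (by omega)
  have hm : 0 < m := hB ▸ Fintype.card_pos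
  have : Nonempty (Fin n) := ⟨⟨0, by omega⟩⟩
  have : Nonempty (Fin m) := ⟨⟨0, hm⟩⟩
  have hdB : ∀ j : B, deg (⊤ : SimpleGraph B) j = m - 1 := fun j => by
    have := deg_top j
    omega
  have hdm : ∀ j : Fin m, deg (⊤ : SimpleGraph (Fin m)) j = m - 1 := fun j => by
    have := deg_top j
    rw [Fintype.card_fin] at this
    omega
  refine nonempty_iso_cycleGraph (fun v => ?_) ?_ hn hA
  · have h1 := h.sum_deg_eq
    have h2 := h.sum_deg_sq_eq
    simp only [Fintype.sum_sum_type, deg_graphProduct_inl, deg_graphProduct_inr, hdB, hA, hB,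
      Fintype.card_fin, Finset.sum_const, Finset.card_univ, completeGraph, hdm,
      add_left_inj, deg_cycleGraph hn, smul_eq_mul, Finset.sum_add_distrib] at h1 h2
    -- The first two degree moments agree with those of the cycle, so the variance around 2
    -- vanishes.
    have h3 : ∑ i, ((deg X i : ℤ) - 2) ^ 2 = 0 := by
      have e1 : ∑ i, (deg X i : ℤ) + n * m = n * (2 + m) := by exact_mod_cast h1
      have e2 : ∑ i, ((deg X i : ℤ) + m) ^ 2 = n * (2 + m) ^ 2 := by exact_mod_cast h2
      have e3 : ∑ i, ((deg X i : ℤ) - 2) ^ 2 = ∑ i, (((deg X i : ℤ) + m) ^ 2 -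
          2 * (m + 2) * (deg X i : ℤ) + (4 - m ^ 2)) :=
        Finset.sum_congr rfl fun i _ => by ring
      rw [e3, Finset.sum_add_distrib, Finset.sum_sub_distrib, ← Finset.mul_sum, e2,
        eq_sub_of_add_eq e1, Finset.sum_const, Finset.card_univ, hA, nsmul_eq_mul]
      ring
    have h4 := (Finset.sum_eq_zero_iff_of_nonneg fun i _ => sq_nonneg _).1 h3 v (Finset.mem_univ v)
    have h5 : (deg X v : ℤ) - 2 = 0 := pow_eq_zero_iff two_ne_zero |>.1 h4
    omega
  · obtain ⟨Φ, -, hΦ⟩ := h.exists_isLapIsometry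
    -- The model does not have `m` as an eigenvalue, since the cycle is connected; hence neither
    -- does the join of `X`.
    refine preconnected_of_lap_graphProduct_mulVec (Z := (⊤ : SimpleGraph B)) fun y hy => ?_
    rw [← Φ.map_eq_zero_iff]
    refine eq_zero_of_lap_graphProduct_mulVec (B := Fin m) (X := cycleGraph n)
      cycleGraph_preconnected ?_
    rw [hB] at hy
    rw [Fintype.card_fin, ← map_smul, ← hy, hΦ]

theorem nonempty_iso_of_compSize_eq {G : SimpleGraph V} {n m : ℕ} (hn : 3 ≤ n) (hm : 1 ≤ m)
    (h : LCospectral G (graphProduct (cycleGraph n) (completeGraph (Fin m)))) {u : V}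
    (hu : compSize Gᶜ u = n) (hv : ∀ v, ¬ Gᶜ.Reachable u v → deg Gᶜ v = 0) :
    Nonempty (G ≃g graphProduct (cycleGraph n) (completeGraph (Fin m))) := by
  let S : Set V := {v | Gᶜ.Reachable u v}
  have hS : ∀ a ∈ S, ∀ b ∉ S, G.Adj a b := by
    intro a ha b hb
    by_contra hab
    have : Gᶜ.Adj a b := ⟨fun h' => hb (h' ▸ ha), hab⟩
    exact hb (Reachable.trans ha this.reachable)
  have hS' : ∀ a ∈ Sᶜ, ∀ b ∉ Sᶜ, G.Adj a b := fun a ha b hb =>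
    (hS b (not_not.1 hb) a ha).symm
  obtain ⟨f⟩ := nonempty_iso_graphProduct_induce G S hS
  have hA : Fintype.card S = n := by
    rw [← hu, compSize, Fintype.card_subtype]
    congr!
  have hB : Fintype.card (Sᶜ : Set V) = m := by
    have h1 := h.card_eq
    rw [Fintype.card_sum, Fintype.card_fin, Fintype.card_fin] at h1
    have h2 := Fintype.card_congr f.toEquiv
    rw [Fintype.card_sum] at h2
    omega
  have : Nonempty (Sᶜ : Set V) := Fintype.card_pos_iff.1 (by omega)
  have htop : G.induce Sᶜ = ⊤ := by
    rw [← compl_eq_bot]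
    refine eq_bot_iff_forall_not_adj.2 fun a b hab => ?_
    exact not_adj_of_deg_eq_zero ((deg_compl_induce hS' a).trans (hv a a.2)) b hab
  rw [htop] at f
  obtain ⟨g⟩ := nonempty_iso_cycleGraph_of_lCospectral_join hn hA hB
    ((LCospectral.of_iso f).symm.trans h)
  exact ⟨f.trans (graphProductCongr g
    (Iso.completeGraph (Fintype.equivFinOfCardEq hB)))⟩

theorem LCospectral.exists_compl_cycleGraph_join {G : SimpleGraph V} {n m : ℕ} (hm : 1 ≤ m)
    (h : LCospectral G (graphProduct (cycleGraph n) (completeGraph (Fin m)))) :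
    ∃ Φ, IsLapIsometry Gᶜ (graphProduct (cycleGraph n) (completeGraph (Fin m)))ᶜ Φ := by
  obtain ⟨Φ, hΦ⟩ := h.exists_isLapIsometry
  have : Nonempty (Fin m) := ⟨⟨0, hm⟩⟩
  exact ⟨Φ, hΦ.compl (graphProduct_preconnected _)⟩

theorem nonempty_iso_of_le_four {G : SimpleGraph V} {n m : ℕ} (hn : 3 ≤ n) (hn' : n ≤ 4)
    (hm : 1 ≤ m) (h : LCospectral G (graphProduct (cycleGraph n) (completeGraph (Fin m)))) :
    Nonempty (G ≃g graphProduct (cycleGraph n) (completeGraph (Fin m))) := by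
  obtain ⟨Φ, hΦ⟩ := h.exists_compl_cycleGraph_join hm
  have hc := lCospectral_of_linearEquiv Φ hΦ.2
  have h1 := hc.sum_deg_eq
  have h2 := hc.sum_deg_sq_eq
  have h3 : n * (n - 3) ^ 2 = n * (n - 3) := by interval_cases n <;> rfl
  have key := h1
  rw [sum_deg_compl_cycleGraph_join hn] at h1
  rw [sum_deg_sq_compl_cycleGraph_join hn, h3] at h2
  obtain ⟨f⟩ := nonempty_iso_of_deg_le_one h.card_eq (le_one_of_sum_sq_eq (h2.trans h1.symm))
    (le_one_of_sum_sq_eq ((sum_deg_sq_compl_cycleGraph_join hn).trans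
      (h3.trans (sum_deg_compl_cycleGraph_join hn).symm))) key
  exact ⟨isoOfCompl f⟩

theorem IsLapIsometry.sum_one_sub_inv_compSize {G : SimpleGraph V} {n m : ℕ} (hn : 5 ≤ n)
    {Φ : (V → ℝ) ≃ₗ[ℝ] (Fin n ⊕ Fin m → ℝ)}
    (h : IsLapIsometry Gᶜ (graphProduct (cycleGraph n) (completeGraph (Fin m)))ᶜ Φ) :
    ∑ v, (1 - (compSize Gᶜ v : ℝ)⁻¹) = n - 1 := by
  have : Nonempty (Fin n) := ⟨⟨0, by omega⟩⟩
  have h1 := sum_one_sub_inv_compSize_compl_graphProduct_top (B := Fin m)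
    (preconnected_compl_of_deg_eq_two (deg_cycleGraph (n := n) (by omega)) (by simpa using hn))
  have h2 := (lCospectral_of_linearEquiv Φ h.2).card_eq
  rw [Fintype.card_fin] at h1
  rw [← h1, Finset.sum_sub_distrib, Finset.sum_sub_distrib, h.sum_inv_compSize_eq]
  simp [h2]

theorem nonempty_iso_of_eq_five {G : SimpleGraph V} {m : ℕ}
    (hm : 1 ≤ m) (h : LCospectral G (graphProduct (cycleGraph 5) (completeGraph (Fin m)))) :
    Nonempty (G ≃g graphProduct (cycleGraph 5) (completeGraph (Fin m))) := by
  obtain ⟨Φ, hΦ⟩ := h.exists_compl_cycleGraph_join hm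
  have h1 := hΦ.sum_one_sub_inv_compSize le_rfl
  have hpre := preconnected_compl_of_deg_eq_two (deg_cycleGraph (n := 5) (by omega)) (by simp)
  obtain ⟨u, hu, hv⟩ := exists_compSize_eq_five (by exact_mod_cast h1)
    (hΦ.quadratic (a := 5) (b := 5) fun y => by
      ext (i | j)
      · have := lap_compl_cycleGraph_five_quadratic (y ∘ Sum.inl) i
        have e1 : (lap (graphProduct (cycleGraph 5) (completeGraph (Fin m)))ᶜ *ᵥ y) ∘ Sum.inl =
            lap (cycleGraph 5)ᶜ *ᵥ (y ∘ Sum.inl) :=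
          funext fun k => lap_compl_graphProduct_mulVec_inl _ _ _ k
        simp only [Pi.add_apply, Pi.sub_apply, Pi.smul_apply, lap_compl_graphProduct_mulVec_inl,
          avgMatrix_compl_graphProduct_mulVec_inl hpre, smul_eq_mul, Pi.zero_apply, e1,
          Fintype.card_fin]
        exact_mod_cast this
      · simp [-mulVec_mulVec, lap_compl_graphProduct_mulVec_inr, avgMatrix_compl_graphProduct_mulVec_inr,
          lap_bot_mulVec])
  exact nonempty_iso_of_compSize_eq (by omega) hm h hu hv

theorem exists_compSize_compl_of_six_le {G : SimpleGraph V} {n m : ℕ} (hn : 6 ≤ n) (hm : 1 ≤ m)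
    (h : LCospectral G (graphProduct (cycleGraph n) (completeGraph (Fin m)))) :
    (∃ u, compSize Gᶜ u = n ∧ ∀ v, ¬ Gᶜ.Reachable u v → deg Gᶜ v = 0) ∨
    (n = 6 ∧ ∃ u t, ¬ Gᶜ.Reachable u t ∧ compSize Gᶜ u = 5 ∧ compSize Gᶜ t = 2 ∧
      ∀ v, ¬ Gᶜ.Reachable u v → ¬ Gᶜ.Reachable t v → deg Gᶜ v = 0) := by
  obtain ⟨Φ, hΦ⟩ := h.exists_compl_cycleGraph_join hm
  have hc := lCospectral_of_linearEquiv Φ hΦ.2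
  have : Nonempty (Fin n) := ⟨⟨0, by omega⟩⟩
  have hdeg := deg_cycleGraph (n := n) (by omega)
  have hpre := preconnected_compl_of_deg_eq_two hdeg (by rw [Fintype.card_fin]; omega)
  refine exists_compSize_eq_or_of_six_le hn
    (hc.sum_deg_eq.trans (sum_deg_compl_cycleGraph_join (by omega)))
    (hc.sum_deg_sq_eq.trans (sum_deg_sq_compl_cycleGraph_join (by omega)))
    (hΦ.sum_one_sub_inv_compSize (by omega)) fun v => ?_
  refine hΦ.le_deg (fun y => ?_) v
  have h1 := le_dotProduct_lap_compl_graphProduct_top (B := Fin m) hdeg hpre y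
  rw [Fintype.card_fin] at h1
  refine le_trans (le_of_eq ?_) h1
  norm_num

theorem isLDS_cycleGraph_join {n m : ℕ} (hn : 3 ≤ n) (hn6 : n ≠ 6) (hm : 1 ≤ m) :
    IsLDS (graphProduct (cycleGraph n) (completeGraph (Fin m))) := by
  intro W _ G h
  rcases le_or_gt n 4 with h4 | h4
  · exact nonempty_iso_of_le_four hn h4 hm h
  rcases eq_or_ne n 5 with rfl | h5
  · exact nonempty_iso_of_eq_five hm h
  rcases exists_compSize_compl_of_six_le (by omega) hm h with ⟨u, hu, hv⟩ | ⟨h6, -⟩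
  · exact nonempty_iso_of_compSize_eq hn hm h hu hv
  · exact absurd h6 hn6

end Determined

/-! ### Finite computations on the seven-vertex graphs -/

section ConcreteGraphs

instance graphProductDecidableRelAdj {A B : Type*} (X : SimpleGraph A) (Z : SimpleGraph B)
    [DecidableRel X.Adj] [DecidableRel Z.Adj] : DecidableRel (graphProduct X Z).Adj
  | .inl i, .inl j => decidable_of_iff (X.Adj i j) (by simp)
  | .inr i, .inr j => decidable_of_iff (Z.Adj i j) (by simp)
  | .inl _, .inr _ => isTrue (by simp)
  | .inr _, .inl _ => isTrue (by simp)

instance sumDecidableRelAdj {A B : Type*} (X : SimpleGraph A) (Z : SimpleGraph B)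
    [DecidableRel X.Adj] [DecidableRel Z.Adj] : DecidableRel (X ⊕g Z).Adj
  | .inl i, .inl j => decidable_of_iff (X.Adj i j) (by simp)
  | .inr i, .inr j => decidable_of_iff (Z.Adj i j) (by simp)
  | .inl _, .inr _ => isFalse (by simp)
  | .inr _, .inl _ => isFalse (by simp)

instance pathGraphDecidableRelAdj (n : ℕ) : DecidableRel (pathGraph n).Adj :=
  fun _ _ => decidable_of_iff _ pathGraph_adj.symm

instance : DecidableRel graphH1.Adj := by unfold graphH1; infer_instance

/-- The graph `2P₂ + K₁`. -/
abbrev twoEdgesAndPoint : SimpleGraph ((Fin 2 ⊕ Fin 2) ⊕ Fin 1) :=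
  (pathGraph 2 ⊕g pathGraph 2) ⊕g completeGraph (Fin 1)

/-- The graph `2K₁`. -/
abbrev twoPoints : SimpleGraph (Fin 1 ⊕ Fin 1) :=
  completeGraph (Fin 1) ⊕g completeGraph (Fin 1)

theorem degree_twoEdgesAndPoint_le_one :
    ∀ v, (Finset.univ.filter (twoEdgesAndPoint.Adj v)).card ≤ 1 := by decide +kernel

theorem sum_degree_twoEdgesAndPoint :
    ∑ v, (Finset.univ.filter (twoEdgesAndPoint.Adj v)).card = 4 := by decide +kernel

theorem degree_compl_twoPoints : ∀ v, twoPointsᶜ.degree v = 1 := by decide +kernel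

theorem degree_graphH1 : graphH1.degree (.inl (.inl 0)) = 5 := by decide +kernel

/-- A vertex order of `2K₁ × (2P₂ + K₁)`. -/
def graphH1Index : (Fin 1 ⊕ Fin 1) ⊕ ((Fin 2 ⊕ Fin 2) ⊕ Fin 1) → Fin 7
  | .inl (.inl _) => 0
  | .inl (.inr _) => 1
  | .inr (.inl (.inl i)) => i.castLE (by omega) + 2
  | .inr (.inl (.inr i)) => i.castLE (by omega) + 4
  | .inr (.inr _) => 6

/-- A vertex order of the wheel `C₆ × K₁`. -/
def wheelIndex : Fin 6 ⊕ Fin 1 → Fin 7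
  | .inl i => i.castLE (by omega)
  | .inr _ => 6

/-- A matrix intertwining the Laplacian matrices of `2K₁ × (2P₂ + K₁)` and `C₆ × K₁`. -/
def intertwiner : Matrix (Fin 7) (Fin 7) ℤ :=
  !![2, 0, 2, 0, 2, 0, -4;
     0, 2, 0, 2, 0, 2, -4;
     -2, 0, -2, 0, 4, 0, 2;
     0, -4, 0, 2, 0, 2, 2;
     0, 0, 0, -2, 0, 2, 2;
     2, 0, -2, 0, 0, 0, 2;
     0, 4, 4, 0, -4, -4, 2]

/-- Sixty times the inverse of `intertwiner`. -/
def intertwinerInv : Matrix (Fin 7) (Fin 7) ℤ :=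
  !![10, 0, -3, 2, 2, 17, 2;
     0, 10, 6, -4, 6, 6, 6;
     10, 0, 3, 8, 8, -7, 8;
     0, 10, 6, 11, -9, 6, 6;
     10, 0, 12, 2, 2, 2, 2;
     0, 10, 0, 5, 15, 0, 0;
     0, 0, 6, 6, 6, 6, 6]

theorem intertwiner_mul_inv : (intertwiner.submatrix graphH1Index wheelIndex) *
    (intertwinerInv.submatrix wheelIndex graphH1Index) = 60 := by
  decide +kernel

theorem intertwinerInv_mul : (intertwinerInv.submatrix wheelIndex graphH1Index) *
    (intertwiner.submatrix graphH1Index wheelIndex) = 60 := by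
  decide +kernel

theorem lapMatrix_graphH1_mul_intertwiner :
    graphH1.lapMatrix ℤ * intertwiner.submatrix graphH1Index wheelIndex =
      intertwiner.submatrix graphH1Index wheelIndex *
        (graphProduct (cycleGraph 6) (completeGraph (Fin 1))).lapMatrix ℤ := by
  decide +kernel

/-- Constant row sums, and the equal column sums below, make the intertwiner compatible with the
all-ones blocks of a join. -/
theorem sum_row_intertwiner :
    ∀ i, ∑ j, intertwiner.submatrix graphH1Index wheelIndex i j = 2 := by
  decide +kernel

theorem sum_col_intertwiner :
    ∀ j, ∑ i, intertwiner.submatrix graphH1Index wheelIndex i j = 2 := by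
  decide +kernel

end ConcreteGraphs

/-! ### The exceptional case `n = 6` -/

section WheelSix

open scoped Classical
open Matrix

variable {V A A' B : Type*} [Fintype V] [Fintype A] [Fintype A'] [Fintype B]

/-- The intertwiner is extended by multiplication by `c` on `B`. The hypotheses `hone` and `hsum`
handle the two off-diagonal blocks of the join's Laplacian. -/
theorem lCospectral_graphProduct_of_linearEquiv {X : SimpleGraph A} {X' : SimpleGraph A'}
    (Φ : (A → ℝ) ≃ₗ[ℝ] (A' → ℝ)) (hΦ : ∀ x, Φ (lap X *ᵥ x) = lap X' *ᵥ Φ x) {c : ℝ} (hc : c ≠ 0)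
    (hone : Φ (fun _ => 1) = fun _ => c) (hsum : ∀ x, ∑ i, Φ x i = c * ∑ i, x i)
    (Z : SimpleGraph B) : LCospectral (graphProduct X Z) (graphProduct X' Z) := by
  have hcard : Fintype.card A = Fintype.card A' := (lCospectral_of_linearEquiv Φ hΦ).card_eq
  have hconst : ∀ a : ℝ, Φ (fun _ => a) = fun _ => a * c := by
    intro a
    have h1 : (fun _ : A => a) = a • fun _ => (1 : ℝ) := by ext; simp
    rw [h1, map_smul, hone]
    ext
    simp
  let Ψ : (A ⊕ B → ℝ) ≃ₗ[ℝ] (A' ⊕ B → ℝ) :=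
    (LinearEquiv.sumArrowLequivProdArrow A B ℝ ℝ).trans
      ((Φ.prodCongr (LinearEquiv.smulOfNeZero ℝ (B → ℝ) c hc)).trans
        (LinearEquiv.sumArrowLequivProdArrow A' B ℝ ℝ).symm)
  have hl : ∀ y i, Ψ y (.inl i) = Φ (y ∘ .inl) i := fun y i => rfl
  have hr : ∀ y j, Ψ y (.inr j) = c * y (.inr j) := fun y j => rfl
  refine lCospectral_of_linearEquiv Ψ fun y => ?_
  have hl' : Ψ y ∘ Sum.inl = Φ (y ∘ Sum.inl) := funext (hl y)
  have hr' : Ψ y ∘ Sum.inr = c • (y ∘ Sum.inr) := funext (hr y)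
  ext (i | j)
  · have h1 : (lap (graphProduct X Z) *ᵥ y) ∘ Sum.inl =
        lap X *ᵥ (y ∘ Sum.inl) + (Fintype.card B : ℝ) • (y ∘ Sum.inl) -
          fun _ => ∑ j, y (.inr j) := by
      ext k
      simp [lap_graphProduct_mulVec_inl]
    rw [hl, h1, map_sub, map_add, map_smul, hΦ, hconst, lap_graphProduct_mulVec_inl, hl', hl]
    simp only [Pi.sub_apply, Pi.add_apply, Pi.smul_apply, smul_eq_mul, hr, ← Finset.mul_sum]
    ring
  · have h2 := hsum (y ∘ Sum.inl)
    simp only [Function.comp_apply] at h2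
    rw [hr, lap_graphProduct_mulVec_inr, lap_graphProduct_mulVec_inr, hr', mulVec_smul, hr]
    simp only [hl, h2, Pi.smul_apply, smul_eq_mul, hcard]
    ring

theorem lap_eq_map_lapMatrix (G : SimpleGraph V) [inst : DecidableEq V] [DecidableRel G.Adj] :
    lap G = (G.lapMatrix ℤ).map (Int.cast : ℤ → ℝ) := by
  have h : lap G = G.lapMatrix ℝ := by
    unfold lap
    congr!
  rw [h]
  ext i j
  simp only [lapMatrix, degMatrix, Matrix.sub_apply, Matrix.diagonal_apply, adjMatrix_apply,
    Matrix.map_apply]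
  push_cast
  simp

omit [Fintype A] in
theorem map_intCast_smul_one [DecidableEq A] (k : ℤ) :
    (k • (1 : Matrix A A ℤ)).map (Int.castRingHom ℝ) = (k : ℝ) • 1 := by
  ext i j
  simp only [Matrix.map_apply, Matrix.smul_apply, Matrix.one_apply]
  split_ifs <;> simp

theorem lCospectral_graphProduct_of_intertwiner {X : SimpleGraph A} {X' : SimpleGraph A'}
    [DecidableEq A] [DecidableEq A'] [DecidableRel X.Adj] [DecidableRel X'.Adj]
    {R : Matrix A A' ℤ} {S : Matrix A' A ℤ} {k c : ℤ} (hk : k ≠ 0) (hc : c ≠ 0)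
    (hRS : R * S = k • (1 : Matrix A A ℤ)) (hSR : S * R = k • (1 : Matrix A' A' ℤ))
    (hR : X.lapMatrix ℤ * R = R * X'.lapMatrix ℤ) (hrow : ∀ i, ∑ j, R i j = c)
    (hcol : ∀ j, ∑ i, R i j = c) (Z : SimpleGraph B) :
    LCospectral (graphProduct X Z) (graphProduct X' Z) := by
  have hkR : (k : ℝ) ≠ 0 := by exact_mod_cast hk
  let R' : Matrix A A' ℝ := R.map (Int.castRingHom ℝ)
  let S' : Matrix A' A ℝ := (k : ℝ)⁻¹ • S.map (Int.castRingHom ℝ)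
  have h1 : R' * S' = 1 := by
    have := congrArg (fun M : Matrix A A ℤ => M.map (Int.castRingHom ℝ)) hRS
    simp only [Matrix.map_mul] at this
    rw [Matrix.mul_smul, this, map_intCast_smul_one, smul_smul, inv_mul_cancel₀ hkR, one_smul]
  have h2 : S' * R' = 1 := by
    have := congrArg (fun M : Matrix A' A' ℤ => M.map (Int.castRingHom ℝ)) hSR
    simp only [Matrix.map_mul] at this
    rw [Matrix.smul_mul, this, map_intCast_smul_one, smul_smul, inv_mul_cancel₀ hkR, one_smul]
  have h3 : lap X * R' = R' * lap X' := by
    have := congrArg (fun M : Matrix A A' ℤ => M.map (Int.castRingHom ℝ)) hR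
    simp only [Matrix.map_mul] at this
    rw [lap_eq_map_lapMatrix, lap_eq_map_lapMatrix]
    exact this
  refine (lCospectral_graphProduct_of_linearEquiv (Matrix.toLin'OfInv h2 h1) (fun x => ?_)
    (c := c) (by exact_mod_cast hc) ?_ (fun x => ?_) Z).symm
  · change R' *ᵥ (lap X' *ᵥ x) = lap X *ᵥ (R' *ᵥ x)
    rw [mulVec_mulVec, mulVec_mulVec, h3]
  · ext i
    change (R' *ᵥ fun _ => 1) i = c
    simp only [mulVec, dotProduct, R', map_apply, mul_one, ← hrow i]
    simp
  · change ∑ i, (R' *ᵥ x) i = _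
    simp only [mulVec, dotProduct]
    rw [Finset.sum_comm, Finset.mul_sum]
    refine Finset.sum_congr rfl fun j _ => ?_
    rw [← Finset.sum_mul, ← hcol j]
    simp [R']

theorem nonempty_completeGraph_iso (m : ℕ) :
    Nonempty (completeGraph (Fin (m + 1)) ≃g
      graphProduct (completeGraph (Fin 1)) (completeGraph (Fin m))) := by
  have h : graphProduct (completeGraph (Fin 1)) (completeGraph (Fin m)) = ⊤ := by
    ext (i | i) (j | j) <;> simp
  rw [h]
  exact ⟨Iso.completeGraph ((finSumFinEquiv.trans (finCongr (add_comm 1 m))).symm)⟩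

theorem lCospectral_graphH1_join (m : ℕ) :
    LCospectral (graphProduct graphH1 (completeGraph (Fin m)))
      (graphProduct (cycleGraph 6) (completeGraph (Fin (m + 1)))) := by
  obtain ⟨f⟩ := nonempty_completeGraph_iso m
  refine (lCospectral_graphProduct_of_intertwiner (k := 60) (c := 2) (by norm_num) (by norm_num)
    (R := intertwiner.submatrix graphH1Index wheelIndex)
    (S := intertwinerInv.submatrix wheelIndex graphH1Index)
    (X' := graphProduct (cycleGraph 6) (completeGraph (Fin 1))) ?_ ?_ ?_
    sum_row_intertwiner sum_col_intertwiner _).trans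
    (LCospectral.of_iso ((graphProductAssoc _ _ _).trans (graphProductCongr Iso.refl f.symm)))
  · rw [intertwiner_mul_inv]
    decide +kernel
  · rw [intertwinerInv_mul]
    decide +kernel
  · convert lapMatrix_graphH1_mul_intertwiner

theorem not_nonempty_graphH1_join_iso (m : ℕ) :
    ¬ Nonempty (graphProduct graphH1 (completeGraph (Fin m)) ≃g
      graphProduct (cycleGraph 6) (completeGraph (Fin (m + 1)))) := by
  rintro ⟨f⟩
  -- This vertex has degree `m + 5`, whereas the degrees on the other side are only `m + 3` and `m +
  -- 6`.
  have h1 := deg_iso f (.inl (.inl (.inl 0)))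
  rw [deg_graphProduct_inl, deg_eq_degree graphH1, degree_graphH1, Fintype.card_fin] at h1
  rcases hf : f (.inl (.inl (.inl 0))) with i | j
  · rw [hf, deg_graphProduct_inl, deg_cycleGraph (by norm_num), Fintype.card_fin] at h1
    omega
  · have h2 := deg_top j
    rw [hf, deg_graphProduct_inr, Fintype.card_fin] at h1
    rw [Fintype.card_fin] at h2
    simp only [completeGraph] at h1
    omega

theorem nonempty_iso_graphH1_join {G : SimpleGraph V} {m : ℕ}
    (h : LCospectral G (graphProduct (cycleGraph 6) (completeGraph (Fin (m + 1))))) {u t : V}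
    (hut : ¬ Gᶜ.Reachable u t) (hu : compSize Gᶜ u = 5) (ht : compSize Gᶜ t = 2)
    (hv : ∀ v, ¬ Gᶜ.Reachable u v → ¬ Gᶜ.Reachable t v → deg Gᶜ v = 0) :
    Nonempty (G ≃g graphProduct graphH1 (completeGraph (Fin m))) := by
  let S : Set V := {v | Gᶜ.Reachable u v}
  have hS : ∀ a ∈ S, ∀ b ∉ S, G.Adj a b := by
    intro a ha b hb
    by_contra hab
    have : Gᶜ.Adj a b := ⟨fun h' => hb (h' ▸ ha), hab⟩
    exact hb (Reachable.trans ha this.reachable)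
  have hS' : ∀ a ∈ Sᶜ, ∀ b ∉ Sᶜ, G.Adj a b := fun a ha b hb =>
    (hS b (not_not.1 hb) a ha).symm
  obtain ⟨f⟩ := nonempty_iso_graphProduct_induce G S hS
  have hA : Fintype.card S = 5 := by
    rw [← hu, compSize, Fintype.card_subtype]
    congr!
  have hB : Fintype.card (Sᶜ : Set V) = m + 2 := by
    have h1 := h.card_eq
    rw [Fintype.card_sum, Fintype.card_fin, Fintype.card_fin] at h1
    have h2 := Fintype.card_congr f.toEquiv
    rw [Fintype.card_sum] at h2
    omega
  -- Outside `S` the complement is a single edge, the component of `t`, plus isolated vertices.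
  have hYdeg : ∀ v : (Sᶜ : Set V), deg (G.induce Sᶜ)ᶜ v =
      if Gᶜ.Reachable t v then 1 else 0 := by
    intro v
    rw [deg_compl_induce hS' v]
    split_ifs with htv
    · have h1 := deg_lt_compSize Gᶜ v
      rw [← compSize_congr htv, ht] at h1
      have h2 : deg Gᶜ v ≠ 0 := fun h0 => by
        have := compSize_eq_one_of_deg_eq_zero h0
        rw [← compSize_congr htv, ht] at this
        omega
      omega
    · exact hv v v.2 htv
  have hYsum : ∑ v, deg (G.induce Sᶜ)ᶜ v = 2 := by
    refine (Finset.sum_congr rfl fun v _ => hYdeg v).trans ?_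
    rw [← ht, compSize, Finset.card_filter]
    refine ((Finset.sum_subtype (Finset.univ.filter fun v : V => v ∈ Sᶜ) (by simp)
      (fun v => if Gᶜ.Reachable t v then 1 else 0)).symm.trans
      (Finset.sum_subset (Finset.subset_univ _) fun v _ hvS => ?_)).trans (by congr!)
    have huv : Gᶜ.Reachable u v := by simpa [S] using hvS
    exact if_neg fun htv => hut (huv.trans htv.symm)
  have hYsq : ∑ v, deg (G.induce Sᶜ)ᶜ v ^ 2 = 2 := by
    refine Eq.trans (Finset.sum_congr rfl fun v _ => ?_) hYsum
    rw [hYdeg]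
    split_ifs <;> rfl
  obtain ⟨Φ, hΦ⟩ := ((LCospectral.of_iso f).symm.trans h).exists_compl_cycleGraph_join
    (Nat.succ_pos m)
  have hc := lCospectral_of_linearEquiv Φ hΦ.2
  have h1 := hc.sum_deg_eq
  have h2 := hc.sum_deg_sq_eq
  rw [sum_deg_compl_cycleGraph_join (by norm_num), Fintype.sum_sum_type] at h1
  rw [sum_deg_sq_compl_cycleGraph_join (by norm_num), Fintype.sum_sum_type] at h2
  simp only [deg_compl_graphProduct_inl, deg_compl_graphProduct_inr, hYsum, hYsq] at h1 h2
  have hX : ∀ v, (deg (G.induce S) v : ℤ) = 4 - deg (G.induce S)ᶜ v := by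
    intro v
    have := deg_compl (G.induce S) v
    omega
  -- Removing the edge leaves complement degree sums `18 - 2 = 16` and, for squares, `54 - 2 = 52`
  -- on the five vertices of `S`. Passing back to `G` by `d ↦ 4 - d` gives 4 for both, so `G.induce
  -- S` is a two-edge matching.
  have hXsum : ∑ v, deg (G.induce S) v = 4 := by
    have e1 : ∑ v, (deg (G.induce S)ᶜ v : ℤ) = 16 := by exact_mod_cast Nat.add_right_cancel h1
    have e2 : ∑ v, (deg (G.induce S) v : ℤ) = 4 := by
      rw [Finset.sum_congr rfl fun v _ => hX v, Finset.sum_sub_distrib, e1]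
      simp [hA]
    exact_mod_cast e2
  have hXsq : ∑ v, deg (G.induce S) v ^ 2 = 4 := by
    have e1 : ∑ v, (deg (G.induce S)ᶜ v : ℤ) = 16 := by exact_mod_cast Nat.add_right_cancel h1
    have e2 : ∑ v, (deg (G.induce S)ᶜ v : ℤ) ^ 2 = 52 := by
      exact_mod_cast Nat.add_right_cancel h2
    have e3 : ∑ v, (deg (G.induce S) v : ℤ) ^ 2 = 4 := by
      have e4 : ∀ v, (deg (G.induce S) v : ℤ) ^ 2 =
          16 - 8 * deg (G.induce S)ᶜ v + (deg (G.induce S)ᶜ v : ℤ) ^ 2 := fun v => by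
        rw [hX]; ring
      rw [Finset.sum_congr rfl fun v _ => e4 v, Finset.sum_add_distrib, Finset.sum_sub_distrib,
        ← Finset.mul_sum, e1, e2]
      simp [hA]
    exact_mod_cast e3
  obtain ⟨g⟩ : Nonempty (G.induce S ≃g twoEdgesAndPoint) := by
    refine nonempty_iso_of_deg_le_one (by rw [hA]; rfl)
      (le_one_of_sum_sq_eq (hXsq.trans hXsum.symm)) (fun v => ?_) ?_
    · rw [deg_eq_card_filter]
      convert degree_twoEdgesAndPoint_le_one v
    · refine hXsum.trans (sum_degree_twoEdgesAndPoint.symm.trans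
        (Finset.sum_congr rfl fun v _ => ?_))
      rw [deg_eq_card_filter]
      congr!
  obtain ⟨k⟩ : Nonempty ((G.induce Sᶜ)ᶜ ≃g
      (graphProduct twoPoints (completeGraph (Fin m)))ᶜ) := by
    have d1 : ∀ i, deg (graphProduct twoPoints (completeGraph (Fin m)))ᶜ (.inl i) = 1 := by
      intro i
      rw [deg_compl_graphProduct_inl, deg_eq_degree]
      exact degree_compl_twoPoints i
    have d2 : ∀ j, deg (graphProduct twoPoints (completeGraph (Fin m)))ᶜ (.inr j) = 0 := by
      intro j
      rw [deg_compl_graphProduct_inr, completeGraph, compl_top, deg_bot]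
    refine nonempty_iso_of_deg_le_one (by simp [hB, add_comm])
      (le_one_of_sum_sq_eq (hYsq.trans hYsum.symm)) ?_ ?_
    · rintro (i | j)
      · exact (d1 i).le
      · exact (d2 j).le.trans zero_le_one
    · rw [hYsum, Fintype.sum_sum_type]
      simp [d1, d2]
  exact ⟨(f.trans (graphProductCongr g (isoOfCompl k))).trans
    ((graphProductAssoc _ _ _).symm.trans
      (graphProductCongr (graphProductComm _ _) Iso.refl))⟩

end WheelSix

theorem mainTheorem5 :
    (∀ n m : ℕ, 3 ≤ n → n ≠ 6 → 1 ≤ m →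
      IsLDS (graphProduct (cycleGraph n) (completeGraph (Fin m)))) ∧
    (∀ m : ℕ, 1 ≤ m →
      LCospectral (graphProduct graphH1 (completeGraph (Fin (m - 1))))
        (graphProduct (cycleGraph 6) (completeGraph (Fin m))) ∧
      ¬ Nonempty (graphProduct graphH1 (completeGraph (Fin (m - 1))) ≃g
        graphProduct (cycleGraph 6) (completeGraph (Fin m))) ∧
      ∀ (W : Type) [Fintype W] (H : SimpleGraph W),
        LCospectral H (graphProduct (cycleGraph 6) (completeGraph (Fin m))) →
          Nonempty (H ≃g graphProduct (cycleGraph 6) (completeGraph (Fin m))) ∨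
          Nonempty (H ≃g graphProduct graphH1 (completeGraph (Fin (m - 1))))) := by
  refine ⟨fun n m hn hn6 hm => isLDS_cycleGraph_join hn hn6 hm, fun m hm => ?_⟩
  obtain ⟨k, rfl⟩ := Nat.exists_eq_add_of_le' hm
  rw [Nat.add_sub_cancel]
  refine ⟨lCospectral_graphH1_join k, not_nonempty_graphH1_join_iso k, fun W _ H h => ?_⟩
  rcases exists_compSize_compl_of_six_le le_rfl hm h with
    ⟨u, hu, hv⟩ | ⟨-, u, t, hut, hu, ht, hv⟩
  · exact Or.inl (nonempty_iso_of_compSize_eq (by norm_num) hm h hu hv)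
  · exact Or.inr (nonempty_iso_graphH1_join h hut hu ht hv)
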